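/- Let $L$ be a finite-dimensional Lie algebra over a field $F$ with at least $\dim L$ elements. For $x\in L$ let $E_L(x)=\{y\in L : (\mathrm{ad}\,x)^n y=0 \text{ for some } n\ge 1\}$ be the Engel subalgebra of $x$, and for a subalgebra $U$ of $L$ let its core $U_L$ be the largest ideal of $L$ contained in $U$. Let $\mathcal G$ be the set of all maximal subalgebras $M$ of $L$ such that $E_L(x)\subseteq M$ for some $x\in L$, and let $\mathcal D$ be the set of all $M\in\mathcal G$ of codimension greater than one in $L$. Put $$\gamma(L)=\Bigl(\bigcap_{M\in\mathcal G}M\Bigr)_L,\qquad \delta(L)=\Bigl(\bigcap_{M\in\mathcal D}M\Bigr)_L,$$ where an intersection over the empty set is understood to be $L$. Let $L_1(0)$ be the three-dimensional Lie algebra over $F$ with basis $v_{-1},v_0,v_1$ and products $[v_{-1},v_0]=v_{-1}$, $[v_{-1},v_1]=v_0$, $[v_0,v_1]=v_1$. The Lie algebra $L$ is called supersolvable if there is a chain $0=I_0\subset I_1\subset\dots\subset I_n=L$ of ideals of $L$ with $\dim I_{i+1}/I_i=1$ for all $0\le i<n$. Then $L$ is supersolvable if and only if $\delta(L)=L$ and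 $L/\gamma(L)$ has no ideal isomorphic to $L_1(0)$. -/

import Mathlib

namespace EngelMax

section General

variable (F L : Type*) [Field F] [LieRing L] [LieAlgebra F L]

variable {F L} in
/-- The core `U_L` of a subalgebra `U`: the largest ideal of `L` contained in `U`
(see `isGreatest_core`). -/
def core (U : LieSubalgebra F L) : LieIdeal F L :=
  sSup {I : LieIdeal F L | ∀ x ∈ I, x ∈ U}

variable {F L} in
theorem isGreatest_core (U : LieSubalgebra F L) :
    IsGreatest {I : LieIdeal F L | ∀ x ∈ I, x ∈ U} (core U) := by
  refine ⟨fun x hx => ?_, fun I hI => le_sSup hI⟩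
  have h : (core U).toSubmodule ≤ U.toSubmodule := by
    unfold core
    rw [LieSubmodule.sSup_toSubmodule]
    refine sSup_le ?_
    rintro _ ⟨I, hI, rfl⟩
    exact fun y hy => hI y hy
  exact h hx

/-- The set `𝒢` of maximal (proper) subalgebras of `L` that contain an Engel subalgebra
`E_L(x) = {y | (ad x)ⁿ y = 0 for some n}` for some `x ∈ L`. -/
def setG : Set (LieSubalgebra F L) :=
  {M | IsCoatom M ∧ ∃ x : L, LieSubalgebra.engel F x ≤ M}

/-- The set `ℋ` of subalgebras of `L` of codimension greater than one. -/
def setH : Set (LieSubalgebra F L) :=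
  {M | 1 < Module.finrank F (L ⧸ M.toSubmodule)}

/-- The set `𝒟` of those members of `𝒢` that have codimension greater than one in `L`. -/
def setD : Set (LieSubalgebra F L) :=
  {M | M ∈ setG F L ∧ M ∈ setH F L}

/-- `γ(L)`: the core of the intersection `G(L)` of the members of `𝒢`. If `𝒢` is empty,
the infimum is `⊤`, which is the convention `G(L) = L`. -/
def gamma : LieIdeal F L := core (sInf (setG F L))

/-- `δ(L)`: the core of the intersection `D(L)` of the members of `𝒟`. If `𝒟` is empty,
the infimum is `⊤`, which is the convention `D(L) = L`. -/
def delta : LieIdeal F L := core (sInf (setD F L))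

/-- A (finite-dimensional) Lie algebra is supersolvable if it has a chain
`0 = I₀ ⊂ I₁ ⊂ ⋯ ⊂ Iₙ = L` of ideals of `L` whose successive factors are one-dimensional. -/
def IsSupersolvable : Prop :=
  ∃ (n : ℕ) (I : ℕ → LieIdeal F L), I 0 = ⊥ ∧ I n = ⊤ ∧
    ∀ i < n, I i ≤ I (i + 1) ∧ Module.finrank F (I (i + 1)) = Module.finrank F (I i) + 1

end General

/-- The underlying space of the three-dimensional Lie algebra `L₁(0)` with basis
`v₋₁, v₀, v₁` and products `[v₋₁, v₀] = v₋₁`, `[v₋₁, v₁] = v₀`, `[v₀, v₁] = v₁`.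
The coordinates `0, 1, 2` are those with respect to `v₋₁, v₀, v₁`. -/
def LOneZero (F : Type*) : Type _ := Fin 3 → F

namespace LOneZero

variable {F : Type*} [Field F]

instance : AddCommGroup (LOneZero F) := inferInstanceAs (AddCommGroup (Fin 3 → F))

instance : Module F (LOneZero F) := inferInstanceAs (Module F (Fin 3 → F))

/-- The element `a v₋₁ + b v₀ + c v₁`. -/
def mk (a b c : F) : LOneZero F := ![a, b, c]

/-- The product determined bilinearly and alternatingly by `[v₋₁, v₀] = v₋₁`, `[v₋₁, v₁] = v₀`,
`[v₀, v₁] = v₁`. -/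
instance : Bracket (LOneZero F) (LOneZero F) where
  bracket x y := mk (x 0 * y 1 - x 1 * y 0) (x 0 * y 2 - x 2 * y 0) (x 1 * y 2 - x 2 * y 1)

theorem bracket_zero (x y : LOneZero F) : ⁅x, y⁆ 0 = x 0 * y 1 - x 1 * y 0 := rfl

theorem bracket_one (x y : LOneZero F) : ⁅x, y⁆ 1 = x 0 * y 2 - x 2 * y 0 := rfl

theorem bracket_two (x y : LOneZero F) : ⁅x, y⁆ 2 = x 1 * y 2 - x 2 * y 1 := rfl

theorem add_apply (x y : LOneZero F) (i : Fin 3) : (x + y) i = x i + y i := rfl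

theorem smul_apply (c : F) (x : LOneZero F) (i : Fin 3) : (c • x) i = c * x i := rfl

theorem zero_apply (i : Fin 3) : (0 : LOneZero F) i = 0 := rfl

theorem ext_coord {x y : LOneZero F} (h0 : x 0 = y 0) (h1 : x 1 = y 1) (h2 : x 2 = y 2) :
    x = y := by
  funext i
  fin_cases i
  · exact h0
  · exact h1
  · exact h2

instance : LieRing (LOneZero F) where
  add_lie x y z := by
    apply ext_coord <;> simp only [bracket_zero, bracket_one, bracket_two, add_apply] <;> ring
  lie_add x y z := by
    apply ext_coord <;> simp only [bracket_zero, bracket_one, bracket_two, add_apply] <;> ring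
  lie_self x := by
    apply ext_coord <;> simp only [bracket_zero, bracket_one, bracket_two, zero_apply] <;> ring
  leibniz_lie x y z := by
    apply ext_coord <;> simp only [bracket_zero, bracket_one, bracket_two, add_apply] <;> ring

instance : LieAlgebra F (LOneZero F) where
  lie_smul c x y := by
    apply ext_coord <;> simp only [bracket_zero, bracket_one, bracket_two, smul_apply] <;> ring

end LOneZero

end EngelMax

/-!
Since `δ(L)` is a core, `δ(L) = L` says that every maximal subalgebra containing an Engel
subalgebra has codimension one (`MaxEngelCodimOne`), a condition inherited by quotients.

If `L` is supersolvable, a maximal subalgebra `M` fails to contain some first term `Iᵢ₊₁` of the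
chain of ideals, so `M + Iᵢ₊₁ = L` and `M` has codimension one. Moreover `L`, and with it every
ideal of `L ⧸ γ(L)`, is solvable, whereas `L₁(0)` is simple and perfect.

Conversely, suppose `MaxEngelCodimOne`.

*Solvable case.* By induction on the dimension it is enough to see that a minimal ideal `A`, which
is abelian and has supersolvable quotient `L ⧸ A`, is one-dimensional
(`finrank_le_one_of_isAtom`). If `M` is a proper subalgebra that contains an Engel subalgebra and
satisfies `M + A = L`, then a maximal subalgebra above `M` complements `A`, so `dim A ≤ 1`. If some
`x ∈ [L, L]` is not nilpotent on `A`, then `M = E_L(x)` will do, because `ad x` is nilpotent on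
`L ⧸ A`. Otherwise `[L, L]` annihilates `A` by Engel's theorem, so the eigenspaces in `A` of any
`ad x` are ideals. If every `x` acts on `A` by a scalar, then `dim A = 1`; if `x` does not, then
`ad x` has no eigenvector in `A`, and the sum of all generalized eigenspaces of `ad x` on `L` is
such an `M`.

*Non-solvable case.* Here `L ⧸ γ(L)` has an ideal isomorphic to `L₁(0)`. The ideal `γ(L)` is
nilpotent, so `L ⧸ γ(L)` is not solvable. Choose an ideal `J` minimal over `γ(L)` inside
`γ(L) + R`, where `R` is the last term of the derived series, and an `M ∈ 𝒢` whose core `M_L` does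
not contain `J`. Then `L ⧸ M_L` is not solvable, and it is shown to be isomorphic to the simple
algebra `L₁(0)`, so `J / γ(L)` maps isomorphically onto it.

The isomorphism `L ⧸ M_L ≃ L₁(0)` (`nonempty_lieEquiv_of_core_eq_bot`) is where the size of the
field is used. Passing to the quotient, let `M` be core-free of codimension one. The characteristic
polynomial of `ad (v + t x)`, as a polynomial in `t`, yields an element `y ∉ M` with `ad y` not
nilpotent (`exists_not_isNilpotent_ad_add_smul`), hence a second subalgebra `M'` of codimension one
that contains an Engel subalgebra, and `y ∈ M'`. The filtration `M = L₀ ⊇ L₁ ⊇ ⋯` with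
`Lₖ₊₁ = {x ∈ Lₖ | [x, L] ⊆ Lₖ}` has one-dimensional factors and reaches zero, and its last nonzero
term `Lₘ` is a complement of `M'`. If `m ≥ 2`, there are elements of `M'` of degrees `1` and
`m - 1`; their bracket lies in `M' ∩ Lₘ = 0`, which forces an element of `M ∩ M'` of degree `0` to
annihilate `Lₘ`. Then `Lₘ` normalizes `M'` (`lie_ne_zero_of_notMem_filtration`), which is impossible
for a subalgebra containing an Engel subalgebra.
So `m ≤ 1`; non-solvability gives `m = 1`, and `L` is three-dimensional, with basis taken from
`M'`, `M ∩ M'` and `L₁`.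
-/

namespace EngelMax

open Module

/-! ### Engel subalgebras, cores and quotients -/

section Basics

variable (F L : Type*) [Field F] [LieRing L] [LieAlgebra F L]

/-- The condition `δ(L) = L` in elementary form: every maximal subalgebra containing an Engel
subalgebra has codimension at most one. -/
def MaxEngelCodimOne : Prop :=
  ∀ M ∈ setG F L, finrank F (L ⧸ M.toSubmodule) ≤ 1

theorem core_eq_top_iff (U : LieSubalgebra F L) : core U = ⊤ ↔ U = ⊤ := by
  constructor
  · intro h
    refine eq_top_iff.2 fun x _ => (isGreatest_core U).1 x ?_
    rw [h]
    trivial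
  · rintro rfl
    exact top_le_iff.1 ((isGreatest_core ⊤).2 fun x _ => LieSubalgebra.mem_top x)

theorem delta_eq_top_iff : delta F L = ⊤ ↔ MaxEngelCodimOne F L := by
  rw [delta, core_eq_top_iff, sInf_eq_top]
  constructor
  · intro h M hM
    by_contra! hc
    exact hM.1.1 (h M ⟨hM, hc⟩)
  · intro h M hM
    exact absurd (h M hM.1) (not_le.2 hM.2)

variable {F L}

theorem core_le {U : LieSubalgebra F L} {x : L} (hx : x ∈ core U) : x ∈ U :=
  (isGreatest_core U).1 x hx

theorem le_core {U : LieSubalgebra F L} {I : LieIdeal F L} (h : ∀ x ∈ I, x ∈ U) : I ≤ core U :=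
  (isGreatest_core U).2 h

theorem mem_gamma_iff {x : L} : x ∈ gamma F L ↔ ∀ M ∈ setG F L, x ∈ core M := by
  constructor
  · intro hx M hM
    refine le_core (I := gamma F L) (fun y hy => ?_) hx
    exact (sInf_le hM : sInf (setG F L) ≤ M) (core_le hy)
  · intro hx
    refine le_core (I := LieSubmodule.lieSpan F L {x}) (fun y hy => ?_)
      (LieSubmodule.subset_lieSpan rfl)
    rw [← SetLike.mem_coe, LieSubalgebra.coe_sInf, Set.mem_iInter₂]
    intro M hM
    have hle : LieSubmodule.lieSpan F L {x} ≤ core M :=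
      LieSubmodule.lieSpan_le.2 (Set.singleton_subset_iff.2 (hx M hM))
    exact core_le (hle hy)

theorem exists_sub_smul_mem {V : Type*} [AddCommGroup V] [Module F V] [FiniteDimensional F V]
    {W : Submodule F V} (h : finrank F (V ⧸ W) ≤ 1) {v : V} (hv : v ∉ W) (l : V) :
    ∃ c : F, l - c • v ∈ W := by
  obtain ⟨w, hw⟩ := finrank_le_one_iff.1 h
  obtain ⟨a, ha⟩ := hw (W.mkQ v)
  obtain ⟨b, hb⟩ := hw (W.mkQ l)
  have ha0 : a ≠ 0 := by
    rintro rfl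
    rw [zero_smul] at ha
    exact hv ((Submodule.Quotient.mk_eq_zero W).1 ha.symm)
  refine ⟨b * a⁻¹, ?_⟩
  rw [← Submodule.ker_mkQ W, LinearMap.mem_ker, map_sub, map_smul, ← ha, ← hb, smul_smul,
    mul_assoc, inv_mul_cancel₀ ha0, mul_one, sub_self]

/-- The canonical projection onto a quotient by an ideal, as a morphism of Lie algebras. -/
def quotientHom (I : LieIdeal F L) : L →ₗ⁅F⁆ L ⧸ I :=
  { I.toSubmodule.mkQ with
    map_lie' := fun {_ _} => rfl }

theorem quotientHom_surjective (I : LieIdeal F L) : Function.Surjective (quotientHom I) :=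
  Submodule.mkQ_surjective I.toSubmodule

theorem quotientHom_eq_zero {I : LieIdeal F L} {x : L} : quotientHom I x = 0 ↔ x ∈ I :=
  Submodule.Quotient.mk_eq_zero I.toSubmodule

theorem finrank_quotient_add (I : LieIdeal F L) [FiniteDimensional F L] :
    finrank F (L ⧸ I) + finrank F I = finrank F L :=
  I.toSubmodule.finrank_quotient_add_finrank

theorem derivedSeries_le_iff_isSolvable_quotient {I : LieIdeal F L} :
    (∃ k, LieAlgebra.derivedSeries F L k ≤ I) ↔ LieAlgebra.IsSolvable (L ⧸ I) := by
  rw [LieAlgebra.isSolvable_iff F]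
  refine exists_congr fun k => ?_
  rw [← LieIdeal.derivedSeries_map_eq k (quotientHom_surjective I), LieIdeal.map_eq_bot_iff]
  have : (quotientHom I).ker = I := by
    ext x
    rw [LieHom.mem_ker, quotientHom_eq_zero]
  rw [this]

theorem isSolvable_of_quotient (I : LieIdeal F L) [LieAlgebra.IsSolvable I]
    [h : LieAlgebra.IsSolvable (L ⧸ I)] : LieAlgebra.IsSolvable L := by
  obtain ⟨k, hk⟩ := derivedSeries_le_iff_isSolvable_quotient.2 h
  obtain ⟨l, hl⟩ := (LieAlgebra.isSolvable_iff F I).1 (‹LieAlgebra.IsSolvable I›)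
  rw [LieIdeal.derivedSeries_eq_bot_iff] at hl
  refine LieAlgebra.IsSolvable.mk (R := F) (k := l + k) ?_
  rw [LieAlgebra.derivedSeries_def, LieAlgebra.derivedSeriesOfIdeal_add, eq_bot_iff, ← hl]
  exact LieAlgebra.derivedSeriesOfIdeal_mono hk l

section Surjective

variable {L' : Type*} [LieRing L'] [LieAlgebra F L'] {f : L →ₗ⁅F⁆ L'}

theorem map_ad_pow (f : L →ₗ⁅F⁆ L') (x y : L) (n : ℕ) :
    f ((LieAlgebra.ad F L x ^ n) y) = (LieAlgebra.ad F L' (f x) ^ n) (f y) := by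
  induction n with
  | zero => rfl
  | succ n ih => simp [pow_succ', ih]

theorem isCoatom_comap (hf : Function.Surjective f) {M : LieSubalgebra F L'} (hM : IsCoatom M) :
    IsCoatom (M.comap f) := by
  refine ⟨fun h => hM.1 ?_, fun U hU => ?_⟩
  · refine eq_top_iff.2 fun y _ => ?_
    obtain ⟨x, rfl⟩ := hf y
    have hx : x ∈ M.comap f := h ▸ LieSubalgebra.mem_top x
    exact hx
  · obtain ⟨u, huU, huM⟩ := SetLike.exists_of_lt hU
    have hlt : M < U.map f := by
      refine lt_of_le_of_ne (fun y hy => ?_) ?_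
      · obtain ⟨x, rfl⟩ := hf y
        exact (LieSubalgebra.mem_map f U _).2 ⟨x, hU.le hy, rfl⟩
      · intro h
        refine huM ?_
        have : f u ∈ U.map f := (LieSubalgebra.mem_map f U _).2 ⟨u, huU, rfl⟩
        rw [← h] at this
        exact this
    have htop := hM.2 _ hlt
    refine eq_top_iff.2 fun x _ => ?_
    have hx : f x ∈ U.map f := htop ▸ LieSubalgebra.mem_top _
    obtain ⟨x', hx', he⟩ := (LieSubalgebra.mem_map f U _).1 hx
    have hk : x - x' ∈ U := by
      refine hU.le ?_
      change f (x - x') ∈ M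
      rw [map_sub, he, sub_self]
      exact M.zero_mem
    simpa using U.add_mem hk hx'

theorem comap_mem_setG (hf : Function.Surjective f) {M : LieSubalgebra F L'}
    (hM : M ∈ setG F L') : M.comap f ∈ setG F L := by
  obtain ⟨hc, y, hy⟩ := hM
  obtain ⟨x, rfl⟩ := hf y
  refine ⟨isCoatom_comap hf hc, x, fun z hz => ?_⟩
  obtain ⟨n, hn⟩ := (LieSubalgebra.mem_engel_iff F x z).1 hz
  refine hy ((LieSubalgebra.mem_engel_iff F _ _).2 ⟨n, ?_⟩)
  exact (map_ad_pow f x z n).symm.trans (by rw [hn, map_zero])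

theorem MaxEngelCodimOne.of_surjective (h : MaxEngelCodimOne F L) (hf : Function.Surjective f)
    [FiniteDimensional F L] : MaxEngelCodimOne F L' := by
  intro M hM
  refine le_trans ?_ (h _ (comap_mem_setG hf hM))
  let g : (L ⧸ (M.comap f).toSubmodule) →ₗ[F] L' ⧸ M.toSubmodule :=
    Submodule.mapQ _ _ (f : L →ₗ[F] L') (fun x hx => hx)
  have hg : Function.Surjective g := by
    intro y
    obtain ⟨y, rfl⟩ := Submodule.mkQ_surjective _ y
    obtain ⟨x, rfl⟩ := hf y
    exact ⟨Submodule.mkQ _ x, rfl⟩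
  exact LinearMap.finrank_le_finrank_of_surjective hg

end Surjective

variable [FiniteDimensional F L]

/-- A form of Fitting's lemma. -/
theorem engel_sup_eq_top {x : L} {N : Submodule F L} {n : ℕ}
    (h : ∀ l, (LieAlgebra.ad F L x ^ n) l ∈ N) : (LieSubalgebra.engel F x).toSubmodule ⊔ N = ⊤ := by
  obtain ⟨k, hk⟩ := Filter.eventually_atTop.1
    (LieAlgebra.ad F L x).eventually_isCompl_ker_pow_range_pow
  have hc := (hk (max k n) (le_max_left _ _)).sup_eq_top
  refine top_le_iff.1 (hc.symm.le.trans (sup_le_sup (fun y hy => ?_) ?_))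
  · exact (LieSubalgebra.mem_engel_iff F x y).2 ⟨_, hy⟩
  · rintro _ ⟨y, rfl⟩
    have hn : max k n = n + (max k n - n) := by omega
    rw [hn, pow_add]
    exact h _

theorem exists_mem_setG_of_engel_ne_top {x : L} (h : LieSubalgebra.engel F x ≠ ⊤) :
    ∃ M ∈ setG F L, LieSubalgebra.engel F x ≤ M := by
  obtain h' | ⟨M, hM, hle⟩ := eq_top_or_exists_le_coatom (LieSubalgebra.engel F x)
  · exact absurd h' h
  · exact ⟨M, ⟨hM, x, hle⟩, hle⟩

theorem isNilpotent_ad_of_engel_eq_top {x : L} (h : LieSubalgebra.engel F x = ⊤) :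
    IsNilpotent (LieAlgebra.ad F L x) := by
  have := Module.Finite.fg_top (R := F) (M := L)
  rw [Module.End.isNilpotent_iff_of_finite]
  intro y
  exact (LieSubalgebra.mem_engel_iff F x y).1 (h ▸ LieSubalgebra.mem_top y)

theorem engel_eq_top_of_mem_gamma {x : L} (hx : x ∈ gamma F L) : LieSubalgebra.engel F x = ⊤ := by
  by_contra h
  obtain ⟨M, hM, hle⟩ := exists_mem_setG_of_engel_ne_top h
  have h1 := engel_sup_eq_top (x := x) (N := (gamma F L).toSubmodule) (n := 1) fun l => by
    rw [pow_one, LieAlgebra.ad_apply]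
    exact lie_mem_left F L _ _ _ hx
  refine hM.1.1 (eq_top_iff.2 fun y _ => ?_)
  have h2 : (LieSubalgebra.engel F x).toSubmodule ⊔ (gamma F L).toSubmodule ≤ M.toSubmodule :=
    sup_le hle fun z hz => core_le (mem_gamma_iff.1 hz M hM)
  exact h2 (h1 ▸ Submodule.mem_top)

/-- The ideal `γ(L)` consists of `ad`-nilpotent elements, so it is nilpotent by Engel's theorem. -/
theorem isSolvable_gamma : LieAlgebra.IsSolvable (gamma F L) := by
  have : LieRing.IsNilpotent (gamma F L) := by
    rw [LieAlgebra.isNilpotent_iff_forall (R := F)]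
    intro x
    obtain ⟨n, hn⟩ := isNilpotent_ad_of_engel_eq_top (engel_eq_top_of_mem_gamma x.2)
    refine ⟨n, LinearMap.ext fun y => (gamma F L).incl_injective ?_⟩
    rw [map_ad_pow]
    change (LieAlgebra.ad F L (x : L) ^ n) (y : L) = _
    rw [hn]
    rfl
  infer_instance

end Basics

/-! ### Supersolvable Lie algebras -/

section Supersolvable

variable {F L : Type*} [Field F] [LieRing L] [LieAlgebra F L] [FiniteDimensional F L]

theorem exists_generator_mod {I J : LieIdeal F L} (hle : I ≤ J)
    (h : finrank F J = finrank F I + 1) :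
    ∃ e ∈ J, ∀ j ∈ J, ∃ c : F, j - c • e ∈ I := by
  have hne : I ≠ J := by
    rintro rfl
    omega
  obtain ⟨e, heJ, heI⟩ := SetLike.exists_of_lt (lt_of_le_of_ne hle hne)
  have hlt : I.toSubmodule < I.toSubmodule ⊔ Submodule.span F {e} :=
    lt_of_le_of_ne le_sup_left fun hs => heI <| by
      have : e ∈ I.toSubmodule ⊔ Submodule.span F {e} :=
        Submodule.mem_sup_right (Submodule.mem_span_singleton_self e)
      rw [← hs] at this
      exact this
  have hJ : I.toSubmodule ⊔ Submodule.span F {e} = J.toSubmodule := by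
    refine Submodule.eq_of_le_of_finrank_le (sup_le hle ?_) ?_
    · exact (Submodule.span_singleton_le_iff_mem _ _).2 heJ
    · have := Submodule.finrank_lt_finrank_of_lt hlt
      change finrank F J ≤ _
      change finrank F I < _ at this
      omega
  refine ⟨e, heJ, fun j hj => ?_⟩
  have hj' : j ∈ I.toSubmodule ⊔ Submodule.span F {e} := by
    rw [hJ]
    exact hj
  obtain ⟨i, hi, y, hy, rfl⟩ := Submodule.mem_sup.1 hj'
  obtain ⟨c, rfl⟩ := Submodule.mem_span_singleton.1 hy
  exact ⟨c, by simpa using hi⟩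

/-- Commutators act trivially on a one-dimensional factor of `L` by ideals. -/
theorem lie_mem_of_mem_derived {I J : LieIdeal F L} (hle : I ≤ J)
    (h : finrank F J = finrank F I + 1) {x c : L} (hx : x ∈ ⁅(⊤ : LieIdeal F L), (⊤ : LieIdeal F L)⁆)
    (hc : c ∈ J) : ⁅x, c⁆ ∈ I := by
  obtain ⟨e, heJ, he⟩ := exists_generator_mod hle h
  have key : ∀ a b : L, ⁅⁅a, b⁆, e⁆ ∈ I := by
    intro a b
    obtain ⟨α, hα⟩ := he _ (lie_mem_right F L J a e heJ)
    obtain ⟨β, hβ⟩ := he _ (lie_mem_right F L J b e heJ)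
    have : ⁅⁅a, b⁆, e⁆ = ⁅a, ⁅b, e⁆ - β • e⁆ - ⁅b, ⁅a, e⁆ - α • e⁆
        + (β • (⁅a, e⁆ - α • e) - α • (⁅b, e⁆ - β • e)) := by
      rw [lie_lie, lie_sub, lie_sub, lie_smul, lie_smul, smul_sub, smul_sub, smul_comm α β]
      abel
    rw [this]
    exact I.add_mem (I.sub_mem (lie_mem_right F L I _ _ hβ) (lie_mem_right F L I _ _ hα))
      (I.sub_mem (I.smul_mem _ hα) (I.smul_mem _ hβ))
  have key' : ∀ a b : L, ⁅⁅a, b⁆, c⁆ ∈ I := by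
    intro a b
    obtain ⟨γ, hγ⟩ := he c hc
    have : ⁅⁅a, b⁆, c⁆ = ⁅⁅a, b⁆, c - γ • e⁆ + γ • ⁅⁅a, b⁆, e⁆ := by
      rw [lie_sub, lie_smul, sub_add_cancel]
    rw [this]
    exact I.add_mem (lie_mem_right F L I _ _ hγ) (I.smul_mem _ (key a b))
  rw [← LieSubmodule.mem_toSubmodule, LieSubmodule.lieIdeal_oper_eq_linear_span'] at hx
  induction hx using Submodule.span_induction with
  | mem x hx =>
    obtain ⟨a, -, b, -, rfl⟩ := hx
    exact key' a b
  | zero => rw [zero_lie]; exact I.zero_mem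
  | add x y _ _ hx hy => rw [add_lie]; exact I.add_mem hx hy
  | smul t x _ hx => rw [smul_lie]; exact I.smul_mem _ hx

theorem lie_mem_of_finrank_succ {I J : LieIdeal F L} (hle : I ≤ J)
    (h : finrank F J = finrank F I + 1) {a b : L} (ha : a ∈ J) (hb : b ∈ J) : ⁅a, b⁆ ∈ I := by
  obtain ⟨e, -, he⟩ := exists_generator_mod hle h
  obtain ⟨α, hα⟩ := he a ha
  obtain ⟨β, hβ⟩ := he b hb
  have : ⁅a, b⁆ = ⁅a - α • e, b⁆ + α • ⁅e, b - β • e⁆ := by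
    simp [sub_lie, lie_sub, smul_lie, lie_smul]
  rw [this]
  exact I.add_mem (lie_mem_left F L I _ _ hα) (I.smul_mem _ (lie_mem_right F L I _ _ hβ))

theorem IsSupersolvable.isSolvable (h : IsSupersolvable F L) : LieAlgebra.IsSolvable L := by
  obtain ⟨n, I, h0, hn, hs⟩ := h
  have key : ∀ k ≤ n, LieAlgebra.derivedSeries F L k ≤ I (n - k) := by
    intro k
    induction k with
    | zero => intro _; simp [hn]
    | succ k ih =>
      intro hk
      have ih := ih (by omega)
      obtain ⟨hle, hr⟩ := hs (n - (k + 1)) (by omega)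
      rw [show n - (k + 1) + 1 = n - k by omega] at hle hr
      rw [LieAlgebra.derivedSeries_def, LieAlgebra.derivedSeriesOfIdeal_succ,
        LieSubmodule.lieIdeal_oper_eq_span, LieSubmodule.lieSpan_le]
      rintro _ ⟨⟨a, ha⟩, ⟨b, hb⟩, rfl⟩
      exact lie_mem_of_finrank_succ hle hr (ih ha) (ih hb)
  have := key n le_rfl
  rw [Nat.sub_self, h0] at this
  exact LieAlgebra.IsSolvable.mk (R := F) (k := n) (le_bot_iff.1 this)

omit [FiniteDimensional F L] in
theorem sup_eq_top_of_isCoatom {M : LieSubalgebra F L} (hM : IsCoatom M) {I : LieIdeal F L}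
    (hI : ¬ I.toSubmodule ≤ M.toSubmodule) : M.toSubmodule ⊔ I.toSubmodule = ⊤ := by
  let U : LieSubalgebra F L :=
    { M.toSubmodule ⊔ I.toSubmodule with
      lie_mem' := by
        intro x y hx hy
        obtain ⟨m, hm, i, hi, rfl⟩ := Submodule.mem_sup.1 hx
        obtain ⟨m', hm', i', hi', rfl⟩ := Submodule.mem_sup.1 hy
        rw [lie_add, add_lie, add_assoc]
        exact Submodule.add_mem_sup (M.lie_mem hm hm')
          (I.add_mem (lie_mem_left F L I _ _ hi) (lie_mem_right F L I _ _ hi')) }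
  have hU : M.toSubmodule ⊔ I.toSubmodule = U.toSubmodule := rfl
  have hlt : M < U := by
    refine lt_of_le_of_ne (le_sup_left : M.toSubmodule ≤ M.toSubmodule ⊔ I.toSubmodule) ?_
    intro h
    apply hI
    rw [h, ← hU]
    exact le_sup_right
  rw [hU, hM.2 U hlt]
  rfl

/-- Every maximal subalgebra of a supersolvable Lie algebra has codimension one. -/
theorem IsSupersolvable.maxEngelCodimOne (h : IsSupersolvable F L) : MaxEngelCodimOne F L := by
  classical
  obtain ⟨n, I, h0, hn, hs⟩ := h
  intro M hM
  have hex : ∃ i, ¬ (I i).toSubmodule ≤ M.toSubmodule := by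
    refine ⟨n, fun hle => hM.1.1 (eq_top_iff.2 fun x _ => hle ?_)⟩
    rw [hn]
    trivial
  have hi := Nat.find_spec hex
  have hmin := fun j => Nat.find_min hex (m := j)
  have hle : Nat.find hex ≤ n := Nat.find_min' hex fun hle =>
    hM.1.1 (eq_top_iff.2 fun x _ => hle (by rw [hn]; trivial))
  generalize Nat.find hex = i at hi hmin hle
  obtain _ | i := i
  · exact absurd (by rw [h0]; exact bot_le) hi
  · have hIi := not_not.1 (hmin i (Nat.lt_succ_self i))
    obtain ⟨hII, hr⟩ := hs i hle
    obtain ⟨e, -, he⟩ := exists_generator_mod hII hr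
    have htop := sup_eq_top_of_isCoatom hM.1 hi
    refine finrank_le_one (M.toSubmodule.mkQ e) fun w => ?_
    obtain ⟨l, rfl⟩ := Submodule.mkQ_surjective _ w
    obtain ⟨m, hm, j, hj, rfl⟩ := Submodule.mem_sup.1 (htop ▸ Submodule.mem_top : l ∈ _)
    obtain ⟨c, hc⟩ := he j hj
    refine ⟨c, ?_⟩
    rw [← map_smul, ← sub_eq_zero, ← map_sub, ← LinearMap.mem_ker, Submodule.ker_mkQ]
    rw [← neg_mem_iff, show -(c • e - (m + j)) = m + (j - c • e) by abel]
    exact M.add_mem hm (hIi hc)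

theorem finrank_comap_quotientHom (A : LieIdeal F L) (J : LieIdeal F (L ⧸ A)) :
    finrank F (J.comap (quotientHom A)) = finrank F J + finrank F A := by
  let g : J.comap (quotientHom A) →ₗ[F] L ⧸ A :=
    A.toSubmodule.mkQ.domRestrict (J.comap (quotientHom A)).toSubmodule
  have hr : LinearMap.range g = J.toSubmodule := by
    ext y
    constructor
    · rintro ⟨x, rfl⟩
      exact x.2
    · intro hy
      obtain ⟨x, rfl⟩ := quotientHom_surjective A y
      exact ⟨⟨x, hy⟩, rfl⟩
  have hk : finrank F (LinearMap.ker g) = finrank F A := by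
    have hA : A.toSubmodule ≤ (J.comap (quotientHom A)).toSubmodule := by
      intro x hx
      change quotientHom A x ∈ J
      rw [quotientHom_eq_zero.2 hx]
      exact J.zero_mem
    have : LinearMap.ker g = A.toSubmodule.comap (J.comap (quotientHom A)).toSubmodule.subtype := by
      ext x
      exact quotientHom_eq_zero (I := A) (x := x)
    rw [this]
    exact (Submodule.comapSubtypeEquivOfLe hA).finrank_eq
  have := LinearMap.finrank_range_add_finrank_ker g
  rw [hr, hk] at this
  exact this.symm

/-- A supersolvable quotient `L ⧸ A` is seen in `L` as a chain of ideals from `A` to `L`. -/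
theorem IsSupersolvable.exists_chain {A : LieIdeal F L} (h : IsSupersolvable F (L ⧸ A)) :
    ∃ (n : ℕ) (J : ℕ → LieIdeal F L), J 0 = A ∧ J n = ⊤ ∧
      ∀ i < n, J i ≤ J (i + 1) ∧ finrank F (J (i + 1)) = finrank F (J i) + 1 := by
  obtain ⟨n, I, h0, hn, hs⟩ := h
  refine ⟨n, fun i => (I i).comap (quotientHom A), ?_, ?_, fun i hi => ⟨?_, ?_⟩⟩
  · ext x
    simp only [h0]
    rw [LieIdeal.mem_comap, LieSubmodule.mem_bot, quotientHom_eq_zero]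
  · ext x
    simp only [hn]
    rw [LieIdeal.mem_comap]
    simp
  · exact LieIdeal.comap_mono (hs i hi).1
  · rw [finrank_comap_quotientHom, finrank_comap_quotientHom, (hs i hi).2]
    omega

theorem IsSupersolvable.of_quotient {A : LieIdeal F L} (hA : finrank F A = 1)
    (h : IsSupersolvable F (L ⧸ A)) : IsSupersolvable F L := by
  obtain ⟨n, J, h0, hn, hs⟩ := h.exists_chain
  refine ⟨n + 1, fun i => i.casesOn ⊥ J, rfl, hn, fun i hi => ?_⟩
  obtain _ | i := i
  · refine ⟨bot_le, ?_⟩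
    change finrank F (J 0) = finrank F (⊥ : LieIdeal F L) + 1
    rw [h0, hA]
    have : finrank F (⊥ : LieIdeal F L) = 0 := finrank_bot F L
    rw [this]
  · exact hs i (by omega)

end Supersolvable

/-! ### Minimal ideals of solvable Lie algebras -/

section Solvable

variable {F L : Type*} [Field F] [LieRing L] [LieAlgebra F L] [FiniteDimensional F L]

omit [FiniteDimensional F L] in
theorem lie_eq_zero_of_isAtom [LieAlgebra.IsSolvable L] {A : LieIdeal F L} (hA : IsAtom A) {a b : L}
    (ha : a ∈ A) (hb : b ∈ A) : ⁅a, b⁆ = 0 := by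
  have hle : ⁅A, A⁆ ≤ A := LieSubmodule.lie_le_right A A
  obtain h | h := hA.le_iff.1 hle
  · rw [← LieSubmodule.mem_bot (R := F) (L := L), ← h]
    exact LieSubmodule.lie_mem_lie ha hb
  · exfalso
    have key : ∀ k, LieAlgebra.derivedSeriesOfIdeal F L k A = A := by
      intro k
      induction k with
      | zero => rfl
      | succ k ih => rw [LieAlgebra.derivedSeriesOfIdeal_succ, ih, h]
    obtain ⟨k, hk⟩ := (LieAlgebra.isSolvable_iff F L).1 inferInstance
    apply hA.1
    rw [eq_bot_iff, ← hk, ← key k]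
    exact LieAlgebra.derivedSeriesOfIdeal_mono le_top k

/-- A proper subalgebra that contains an Engel subalgebra and supplements a minimal abelian ideal
`A` lies in a maximal subalgebra complementing `A`, whose codimension is `dim A`. -/
theorem finrank_le_one_of_supplement (hC : MaxEngelCodimOne F L) {A : LieIdeal F L} (hA : IsAtom A)
    (hab : ∀ a ∈ A, ∀ b ∈ A, ⁅a, b⁆ = 0) {M : LieSubalgebra F L} {x : L}
    (hx : LieSubalgebra.engel F x ≤ M) (hM : M ≠ ⊤)
    (hsup : M.toSubmodule ⊔ A.toSubmodule = ⊤) : finrank F A ≤ 1 := by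
  obtain h' | ⟨N, hN, hle⟩ := eq_top_or_exists_le_coatom M
  · exact absurd h' hM
  have hsupN : N.toSubmodule ⊔ A.toSubmodule = ⊤ :=
    top_le_iff.1 (hsup.symm.le.trans
      (sup_le_sup_right (show M.toSubmodule ≤ N.toSubmodule from hle) _))
  let B : LieIdeal F L :=
    { N.toSubmodule ⊓ A.toSubmodule with
      lie_mem := by
        rintro l b ⟨hbN, hbA⟩
        obtain ⟨m, hm, a, ha, rfl⟩ := Submodule.mem_sup.1 (hsupN ▸ Submodule.mem_top : l ∈ _)
        rw [add_lie, hab a ha b hbA, add_zero]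
        exact ⟨N.lie_mem hm hbN, lie_mem_right F L A _ _ hbA⟩ }
  have hB : B ≤ A := fun x hx => hx.2
  have hdisj : N.toSubmodule ⊓ A.toSubmodule = ⊥ := by
    obtain h | h := hA.le_iff.1 hB
    · have : B.toSubmodule = ⊥ := by rw [h]; rfl
      exact this
    · exfalso
      refine hN.1 ?_
      have hAN : A.toSubmodule ≤ N.toSubmodule := by
        intro a ha
        rw [← h] at ha
        exact ha.1
      rw [sup_eq_left.2 hAN] at hsupN
      exact eq_top_iff.2 fun y _ => (hsupN ▸ Submodule.mem_top : y ∈ N.toSubmodule)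
  have h1 := hC N ⟨hN, x, hx.trans hle⟩
  have h2 := N.toSubmodule.finrank_quotient_add_finrank
  have h3 := Submodule.finrank_add_finrank_le_of_disjoint (disjoint_iff.2 hdisj)
  change _ + finrank F A ≤ _ at h3
  omega

omit [FiniteDimensional F L] in
theorem lie_mem_iSup_maxGenEigenspace {x y z : L}
    (hy : y ∈ ⨆ μ : F, (LieAlgebra.ad F L x).maxGenEigenspace μ)
    (hz : z ∈ ⨆ μ : F, (LieAlgebra.ad F L x).maxGenEigenspace μ) :
    ⁅y, z⁆ ∈ ⨆ μ : F, (LieAlgebra.ad F L x).maxGenEigenspace μ := by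
  induction hy using Submodule.iSup_induction' with
  | zero => rw [zero_lie]; exact Submodule.zero_mem _
  | add _ _ _ _ h1 h2 => rw [add_lie]; exact Submodule.add_mem _ h1 h2
  | mem μ y hy =>
    induction hz using Submodule.iSup_induction' with
    | zero => rw [lie_zero]; exact Submodule.zero_mem _
    | add _ _ _ _ h1 h2 => rw [lie_add]; exact Submodule.add_mem _ h1 h2
    | mem ν z hz =>
      exact Submodule.mem_iSup_of_mem (μ + ν) (LieModule.lie_mem_maxGenEigenspace_toEnd hy hz)

/-- The sum of all generalized eigenspaces of `ad x`, which is a subalgebra of `L` containing the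
Engel subalgebra of `x`. -/
def eigenSubalgebra (F : Type*) {L : Type*} [Field F] [LieRing L] [LieAlgebra F L]
    [FiniteDimensional F L] (x : L) : LieSubalgebra F L :=
  { ⨆ μ : F, (LieAlgebra.ad F L x).maxGenEigenspace μ with
    lie_mem' := lie_mem_iSup_maxGenEigenspace }

theorem engel_le_eigenSubalgebra (x : L) : LieSubalgebra.engel F x ≤ eigenSubalgebra F x :=
  fun _ hy => Submodule.mem_iSup_of_mem (p := fun μ : F => (LieAlgebra.ad F L x).maxGenEigenspace μ)
    0 hy

/-- The generalized eigenspaces of `T` span a subspace `W` such that `T - α` is injective on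
`V ⧸ W`: on the eigenspaces for `μ ≠ α` the map `T - α` is bijective. -/
theorem mem_iSup_maxGenEigenspace_of_sub_mem {V : Type*} [AddCommGroup V] [Module F V]
    [FiniteDimensional F V] (T : End F V) (α : F) {v : V}
    (h : T v - α • v ∈ ⨆ μ : F, T.maxGenEigenspace μ) : v ∈ ⨆ μ : F, T.maxGenEigenspace μ := by
  have hmem : ∀ w ∈ ⨆ μ : F, T.maxGenEigenspace μ,
      ∃ u ∈ ⨆ μ : F, T.maxGenEigenspace μ, w - (T u - α • u) ∈ T.maxGenEigenspace α := by
    intro w hw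
    induction hw using Submodule.iSup_induction' with
    | zero => exact ⟨0, Submodule.zero_mem _, by simp⟩
    | add w w' _ _ h1 h2 =>
      obtain ⟨u, hu, hu'⟩ := h1
      obtain ⟨z, hz, hz'⟩ := h2
      refine ⟨u + z, Submodule.add_mem _ hu hz, ?_⟩
      rw [map_add, smul_add, show w + w' - (T u + T z - (α • u + α • z)) =
        (w - (T u - α • u)) + (w' - (T z - α • z)) by abel]
      exact Submodule.add_mem _ hu' hz'
    | mem μ w hw =>
      obtain rfl | hne := eq_or_ne μ α
      · exact ⟨0, Submodule.zero_mem _, by simpa using hw⟩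
      · have hmaps : ∀ z ∈ T.maxGenEigenspace μ, (T - algebraMap F (End F V) α) z ∈
            T.maxGenEigenspace μ := by
          intro z hz
          rw [LinearMap.sub_apply, Module.algebraMap_end_apply]
          exact Submodule.sub_mem _ (T.mapsTo_maxGenEigenspace_of_comm (Commute.refl T) μ hz)
            (Submodule.smul_mem _ _ hz)
        let S : End F (T.maxGenEigenspace μ) := (T - algebraMap F (End F V) α).restrict hmaps
        have hinj : Function.Injective S := by
          rw [← LinearMap.ker_eq_bot, eq_bot_iff]
          intro z hz
          have hz' : T z - α • (z : V) = 0 := congrArg Subtype.val (LinearMap.mem_ker.1 hz)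
          have hzα : (z : V) ∈ T.maxGenEigenspace α := by
            rw [End.mem_maxGenEigenspace]
            exact ⟨1, by simpa using hz'⟩
          have hd := T.disjoint_genEigenspace hne ⊤ ⊤
          exact Subtype.ext (Submodule.disjoint_def.1 hd _ z.2 hzα)
        obtain ⟨u, hu⟩ := LinearMap.surjective_of_injective hinj ⟨w, hw⟩
        refine ⟨u, Submodule.mem_iSup_of_mem μ u.2, ?_⟩
        have : T u - α • (u : V) = w := congrArg Subtype.val hu
        rw [this, sub_self]
        exact Submodule.zero_mem _
  obtain ⟨u, hu, hu'⟩ := hmem _ h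
  have hvu : v - u ∈ T.maxGenEigenspace α := by
    rw [End.mem_maxGenEigenspace] at hu' ⊢
    obtain ⟨k, hk⟩ := hu'
    refine ⟨k + 1, ?_⟩
    rw [pow_succ, Module.End.mul_apply]
    convert hk using 2
    simp only [map_sub, LinearMap.sub_apply, LinearMap.smul_apply, End.one_apply]
  rw [← sub_add_cancel v u]
  exact Submodule.add_mem _ (Submodule.mem_iSup_of_mem α hvu) hu


/-- If `ad x` acts triangularly on `L ⧸ A` and has no eigenvector in `A`, then its generalized
eigenspaces together with `A` span `L`: modulo `A`, each step up the chain of ideals solves an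
equation `(ad x - α) e ∈ eigenSubalgebra x`. -/
theorem eigenSubalgebra_sup_eq_top {A : LieIdeal F L} (h : IsSupersolvable F (L ⧸ A)) {x : L}
    (hx : ∀ α : F, ∀ a ∈ A, ⁅x, a⁆ = α • a → a = 0) :
    (eigenSubalgebra F x).toSubmodule ⊔ A.toSubmodule = ⊤ := by
  obtain ⟨n, J, h0, hn, hs⟩ := h.exists_chain
  have key : ∀ i ≤ n, (J i).toSubmodule ≤ (eigenSubalgebra F x).toSubmodule ⊔ A.toSubmodule := by
    intro i
    induction i with
    | zero => intro _; rw [h0]; exact le_sup_right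
    | succ i ih =>
      intro hi
      have ih := ih (by omega)
      obtain ⟨hle, hr⟩ := hs i (by omega)
      obtain ⟨e, heJ, he⟩ := exists_generator_mod hle hr
      obtain ⟨α, hα⟩ := he _ (lie_mem_right F L _ x e heJ)
      obtain ⟨m, hm, a, ha, hma⟩ := Submodule.mem_sup.1 (ih hα)
      -- `ad x - α` is injective, hence surjective, on `A`.
      let S : A →ₗ[F] A := (LieAlgebra.ad F L x - algebraMap F (End F L) α).restrict
        (p := A.toSubmodule) (q := A.toSubmodule) fun z hz => by
          rw [LinearMap.sub_apply, Module.algebraMap_end_apply, LieAlgebra.ad_apply]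
          exact A.sub_mem (lie_mem_right F L A _ _ hz) (A.smul_mem _ hz)
      have hinj : Function.Injective S := by
        rw [← LinearMap.ker_eq_bot, eq_bot_iff]
        intro z hz
        have hz' : ⁅x, (z : L)⁆ - α • (z : L) = 0 := congrArg Subtype.val (LinearMap.mem_ker.1 hz)
        exact Subtype.ext (hx α z z.2 (sub_eq_zero.1 hz'))
      obtain ⟨b, hb⟩ := LinearMap.surjective_of_injective hinj ⟨a, ha⟩
      have hb' : ⁅x, (b : L)⁆ - α • (b : L) = a := congrArg Subtype.val hb
      have heb : e - b ∈ (eigenSubalgebra F x).toSubmodule := by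
        refine mem_iSup_maxGenEigenspace_of_sub_mem _ α ?_
        rw [LieAlgebra.ad_apply, lie_sub, smul_sub, show ⁅x, e⁆ - ⁅x, (b : L)⁆ -
          (α • e - α • (b : L)) = (⁅x, e⁆ - α • e) - (⁅x, (b : L)⁆ - α • (b : L)) by abel, hb', ← hma,
          add_sub_cancel_right]
        exact hm
      have heS : e ∈ (eigenSubalgebra F x).toSubmodule ⊔ A.toSubmodule := by
        rw [← sub_add_cancel e (b : L)]
        exact Submodule.add_mem_sup heb b.2
      intro j hj
      obtain ⟨c, hc⟩ := he j hj
      rw [← sub_add_cancel j (c • e)]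
      exact Submodule.add_mem _ (ih hc) (Submodule.smul_mem _ _ heS)
  refine top_le_iff.1 (le_trans ?_ (key n le_rfl))
  rw [hn]
  exact le_rfl

theorem eigenSubalgebra_ne_top {A : LieIdeal F L} (hA : A ≠ ⊥) {x : L}
    (hx : ∀ α : F, ∀ a ∈ A, ⁅x, a⁆ = α • a → a = 0) : eigenSubalgebra F x ≠ ⊤ := by
  intro htop
  have h1 : ⨆ μ : F, (LieAlgebra.ad F L x).maxGenEigenspace μ = ⊤ := by
    change (eigenSubalgebra F x).toSubmodule = ⊤
    rw [htop]
    rfl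
  have h2 := Submodule.inf_iSup_genEigenspace (p := A.toSubmodule) (f := LieAlgebra.ad F L x)
    (fun a ha => lie_mem_right F L A _ _ ha) ⊤
  have h3 : ∀ μ : F, A.toSubmodule ⊓ (LieAlgebra.ad F L x).genEigenspace μ ⊤ = ⊥ := by
    intro μ
    rw [eq_bot_iff]
    rintro a ⟨haA, ha⟩
    obtain ⟨k, hk⟩ := (End.mem_maxGenEigenspace _ _ _).1 ha
    clear ha
    induction k generalizing a with
    | zero => simpa using hk
    | succ k ih =>
      refine (Submodule.mem_bot F).2 (hx μ a haA (sub_eq_zero.1 ((Submodule.mem_bot F).1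
        (ih (a := ⁅x, a⁆ - μ • a) ?_ ?_))))
      · exact A.sub_mem (lie_mem_right F L A _ _ haA) (A.smul_mem _ haA)
      · rw [pow_succ, Module.End.mul_apply] at hk
        exact hk
  simp only [h3, iSup_bot] at h2
  have h4 : (⨆ μ : F, (LieAlgebra.ad F L x).genEigenspace μ ⊤) = ⊤ := h1
  rw [h4, inf_top_eq] at h2
  exact hA ((LieSubmodule.toSubmodule_eq_bot A).1 h2)

/-- If the elements of `[L, L]` act nilpotently on a minimal ideal, they annihilate it. -/
theorem lie_eq_zero_of_forall_le_engel {A : LieIdeal F L} (hA : IsAtom A)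
    (h : ∀ x ∈ ⁅(⊤ : LieIdeal F L), (⊤ : LieIdeal F L)⁆, ∀ a ∈ A, a ∈ LieSubalgebra.engel F x)
    {x a : L} (hx : x ∈ ⁅(⊤ : LieIdeal F L), (⊤ : LieIdeal F L)⁆) (ha : a ∈ A) : ⁅x, a⁆ = 0 := by
  let D : LieIdeal F L := ⁅(⊤ : LieIdeal F L), (⊤ : LieIdeal F L)⁆
  have hpow : ∀ (x : D) (a : A) (n : ℕ),
      (((LieModule.toEnd F D A x ^ n) a : A) : L) = (LieAlgebra.ad F L (x : L) ^ n) (a : L) := by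
    intro x a n
    induction n with
    | zero => rfl
    | succ n ih =>
      rw [pow_succ', pow_succ', Module.End.mul_apply, Module.End.mul_apply, ← ih]
      rfl
  have hnil : LieModule.IsNilpotent D A := by
    rw [LieModule.isNilpotent_iff_forall (R := F)]
    intro y
    rw [Module.End.isNilpotent_iff_of_finite]
    intro b
    obtain ⟨n, hn⟩ := (LieSubalgebra.mem_engel_iff F (y : L) (b : L)).1 (h y y.2 b b.2)
    exact ⟨n, Subtype.ext ((hpow y b n).trans hn)⟩
  have hnt : Nontrivial A := (LieSubmodule.nontrivial_iff_ne_bot F L L).2 hA.1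
  have := LieModule.nontrivial_max_triv_of_isNilpotent F D A
  obtain ⟨b, hb⟩ := exists_ne (0 : LieModule.maxTrivSubmodule F D A)
  let B : LieIdeal F L :=
    { carrier := {a | a ∈ A ∧ ∀ d ∈ D, ⁅d, a⁆ = 0}
      add_mem' := fun {a b} ha hb => ⟨A.add_mem ha.1 hb.1, fun d hd => by
        rw [lie_add, ha.2 d hd, hb.2 d hd, add_zero]⟩
      zero_mem' := ⟨A.zero_mem, fun d _ => lie_zero d⟩
      smul_mem' := fun c a ha => ⟨A.smul_mem _ ha.1, fun d hd => by
        rw [lie_smul, ha.2 d hd, smul_zero]⟩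
      lie_mem := fun {l a} ha => ⟨lie_mem_right F L A _ _ ha.1, fun d hd => by
        rw [leibniz_lie, ha.2 d hd, lie_zero, add_zero]
        exact ha.2 _ (lie_mem_left F L D _ _ hd)⟩ }
  have hBA : B ≤ A := fun a ha => ha.1
  obtain hB | hB := hA.le_iff.1 hBA
  · exfalso
    apply hb
    have hbB : (((b : A) : L)) ∈ B :=
      ⟨(b : A).2, fun d hd => congrArg Subtype.val (b.2 (⟨d, hd⟩ : D))⟩
    rw [hB, LieSubmodule.mem_bot] at hbB
    exact Subtype.ext (Subtype.ext hbB)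
  · rw [← hB] at ha
    exact ha.2 x hx

/-- The heart of the solvable case: a minimal ideal of `L` is one-dimensional. -/
theorem finrank_le_one_of_isAtom [LieAlgebra.IsSolvable L] (hC : MaxEngelCodimOne F L)
    {A : LieIdeal F L} (hA : IsAtom A) (h : IsSupersolvable F (L ⧸ A)) : finrank F A ≤ 1 := by
  have hab : ∀ a ∈ A, ∀ b ∈ A, ⁅a, b⁆ = 0 := fun a ha b hb => lie_eq_zero_of_isAtom hA ha hb
  by_cases hnil : ∀ x ∈ ⁅(⊤ : LieIdeal F L), (⊤ : LieIdeal F L)⁆, ∀ a ∈ A,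
      a ∈ LieSubalgebra.engel F x
  · have hkill := fun x hx a ha => lie_eq_zero_of_forall_le_engel hA hnil (x := x) (a := a) hx ha
    by_cases hscalar : ∀ x : L, ∃ α : F, ∀ a ∈ A, ⁅x, a⁆ = α • a
    · obtain ⟨a, haA, ha0⟩ := A.toSubmodule.ne_bot_iff.1
        (mt (LieSubmodule.toSubmodule_eq_bot A).1 hA.1)
      let B : LieIdeal F L :=
        { Submodule.span F {a} with
          lie_mem := by
            intro l b hb
            obtain ⟨c, rfl⟩ := Submodule.mem_span_singleton.1 hb
            obtain ⟨α, hα⟩ := hscalar l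
            rw [hα _ (A.smul_mem c haA)]
            exact Submodule.smul_mem _ _ hb }
      have hBA : B ≤ A := (Submodule.span_singleton_le_iff_mem _ _).2 haA
      have haB : a ∈ B := Submodule.mem_span_singleton_self a
      obtain hB | hB := hA.le_iff.1 hBA
      · rw [hB, LieSubmodule.mem_bot] at haB
        exact absurd haB ha0
      · rw [← hB]
        exact (finrank_span_singleton ha0).le
    · push Not at hscalar
      obtain ⟨x, hx⟩ := hscalar
      -- The eigenspaces of `ad x` in `A` are ideals of `L`, because `[L, L]` annihilates `A`.
      have hev : ∀ α : F, ∀ a ∈ A, ⁅x, a⁆ = α • a → a = 0 := by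
        intro α a haA ha
        let B : LieIdeal F L :=
          { carrier := {a | a ∈ A ∧ ⁅x, a⁆ = α • a}
            add_mem' := fun {a b} ha hb => ⟨A.add_mem ha.1 hb.1, by
              rw [lie_add, ha.2, hb.2, smul_add]⟩
            zero_mem' := ⟨A.zero_mem, by rw [lie_zero, smul_zero]⟩
            smul_mem' := fun c a ha => ⟨A.smul_mem _ ha.1, by
              rw [lie_smul, ha.2, smul_comm]⟩
            lie_mem := fun {l a} ha => ⟨lie_mem_right F L A _ _ ha.1, by
              rw [leibniz_lie, ha.2, lie_smul, hkill _ (LieSubmodule.lie_mem_lie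
                (LieSubmodule.mem_top x) (LieSubmodule.mem_top l)) a ha.1, zero_add]⟩ }
        have hBA : B ≤ A := fun a ha => ha.1
        have haB : a ∈ B := ⟨haA, ha⟩
        obtain hB | hB := hA.le_iff.1 hBA
        · rwa [hB, LieSubmodule.mem_bot] at haB
        · obtain ⟨b, hbA, hb⟩ := hx α
          rw [← hB] at hbA
          exact absurd hbA.2 hb
      exact finrank_le_one_of_supplement hC hA hab (engel_le_eigenSubalgebra x)
        (eigenSubalgebra_ne_top hA.1 hev) (eigenSubalgebra_sup_eq_top h hev)
  · push Not at hnil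
    obtain ⟨x, hx, a, haA, ha⟩ := hnil
    obtain ⟨n, J, h0, hn, hs⟩ := h.exists_chain
    have hpow : ∀ k ≤ n, ∀ l, (LieAlgebra.ad F L x ^ k) l ∈ J (n - k) := by
      intro k
      induction k with
      | zero =>
        intro _ l
        rw [Nat.sub_zero, hn]
        trivial
      | succ k ih =>
        intro hk l
        obtain ⟨hle, hr⟩ := hs (n - (k + 1)) (by omega)
        rw [show n - (k + 1) + 1 = n - k by omega] at hle hr
        rw [pow_succ', Module.End.mul_apply]
        exact lie_mem_of_mem_derived hle hr hx (ih (by omega) l)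
    refine finrank_le_one_of_supplement hC hA hab (x := x) le_rfl ?_ (engel_sup_eq_top (n := n) ?_)
    · intro htop
      exact ha (htop ▸ LieSubalgebra.mem_top a)
    · intro l
      have := hpow n le_rfl l
      rwa [Nat.sub_self, h0] at this

end Solvable

theorem isSupersolvable_of_finrank_eq {F : Type*} [Field F] (n : ℕ) :
    ∀ (L : Type*) [LieRing L] [LieAlgebra F L] [FiniteDimensional F L] [LieAlgebra.IsSolvable L],
      finrank F L = n → MaxEngelCodimOne F L → IsSupersolvable F L := by
  induction n using Nat.strong_induction_on with
  | _ n ih =>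
    intro L _ _ _ _ hn hC
    obtain h0 | ⟨A, hA, -⟩ := eq_bot_or_exists_atom_le (⊤ : LieIdeal F L)
    · exact ⟨0, fun _ => ⊥, rfl, h0.symm, fun i hi => absurd hi (Nat.not_lt_zero i)⟩
    · have hpos : 0 < finrank F A := by
        have := (LieSubmodule.nontrivial_iff_ne_bot F L L).2 hA.1
        exact finrank_pos
      have hq := finrank_quotient_add A
      have : FiniteDimensional F (L ⧸ A) :=
        inferInstanceAs (FiniteDimensional F (L ⧸ A.toSubmodule))
      have : LieAlgebra.IsSolvable (L ⧸ A) :=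
        (quotientHom_surjective A).lieAlgebra_isSolvable
      have h := ih _ (by omega) (L ⧸ A) rfl (hC.of_surjective (quotientHom_surjective A))
      have hle := finrank_le_one_of_isAtom hC hA h
      exact h.of_quotient (by omega)

/-! ### Nilpotency of `ad` along a line -/

section Pencil

theorem natDegree_aeval_linear_le {R σ : Type*} [CommRing R] {f : MvPolynomial σ R} {d : ℕ}
    (hf : f.IsHomogeneous d) (a b : σ → R) :
    (MvPolynomial.aeval (fun i => Polynomial.C (b i) * Polynomial.X + Polynomial.C (a i)) f
      ).natDegree ≤ d := by
  rw [← mul_one d]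
  exact MvPolynomial.aeval_natDegree_le _ hf.totalDegree_le _ fun i =>
    Polynomial.natDegree_linear_le

/-- The leading coefficient in `t` of a form of degree `d` on the line `a + t b` is its value
at `b`. -/
theorem coeff_aeval_linear {R σ : Type*} [CommRing R] {f : MvPolynomial σ R} {d : ℕ}
    (hf : f.IsHomogeneous d) (a b : σ → R) :
    (MvPolynomial.aeval (fun i => Polynomial.C (b i) * Polynomial.X + Polynomial.C (a i)) f
      ).coeff d = MvPolynomial.eval b f := by
  have hprod : ∀ (m : σ →₀ ℕ) (s : Finset σ),
      (∏ i ∈ s, (Polynomial.C (b i) * Polynomial.X + Polynomial.C (a i)) ^ m i).coeff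
        (∑ i ∈ s, m i) = ∏ i ∈ s, b i ^ m i := by
    classical
    intro m s
    have hpow : ∀ i, ((Polynomial.C (b i) * Polynomial.X + Polynomial.C (a i)) ^ m i).natDegree ≤
        m i := fun i => (Polynomial.natDegree_pow_le_of_le (m i)
          Polynomial.natDegree_linear_le).trans_eq (mul_one _)
    induction s using Finset.induction_on with
    | empty => simp
    | insert i s hi ih =>
      rw [Finset.prod_insert hi, Finset.prod_insert hi, Finset.sum_insert hi,
        Polynomial.coeff_mul_add_eq_of_natDegree_le (hpow i)
          ((Polynomial.natDegree_prod_le _ _).trans (Finset.sum_le_sum fun j _ => hpow j)), ih]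
      congr 1
      have := Polynomial.coeff_pow_of_natDegree_le (m := m i)
        (Polynomial.natDegree_linear_le (a := b i) (b := a i))
      rw [mul_one] at this
      simpa using this
  have hmon : ∀ m ∈ f.support, (MvPolynomial.aeval
      (fun i => Polynomial.C (b i) * Polynomial.X + Polynomial.C (a i))
      (MvPolynomial.monomial m (f.coeff m))).coeff d =
      MvPolynomial.eval b (MvPolynomial.monomial m (f.coeff m)) := by
    intro m hm
    have hd : ∑ i ∈ m.support, m i = d := by
      have := hf (MvPolynomial.mem_support_iff.1 hm)
      simpa [Finsupp.weight_apply, Finsupp.sum] using this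
    rw [MvPolynomial.aeval_monomial, MvPolynomial.eval_monomial, Polynomial.algebraMap_eq,
      Polynomial.coeff_C_mul, Finsupp.prod, Finsupp.prod, ← hd, hprod]
  conv_lhs => rw [f.as_sum, map_sum, Polynomial.finsetSum_coeff]
  conv_rhs => rw [f.as_sum, map_sum]
  exact Finset.sum_congr rfl hmon

variable {F L : Type*} [Field F] [LieRing L] [LieAlgebra F L] [FiniteDimensional F L]

/-- If `ad x` is not nilpotent then neither is `ad (v + t x)` for some scalar `t`. The coefficient
of `Xⁱ` in the characteristic polynomial of `ad (v + t x)` is a polynomial in `t` of degree at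
most `dim L - i`; the constant coefficient always vanishes, so `dim L` scalars suffice. -/
theorem exists_not_isNilpotent_ad_add_smul (hF : (finrank F L : Cardinal) ≤ Cardinal.mk F) {x : L}
    (hx : ¬ IsNilpotent (LieAlgebra.ad F L x)) (v : L) :
    ∃ t : F, ¬ IsNilpotent (LieAlgebra.ad F L (v + t • x)) := by
  by_contra! hall
  apply hx
  let φ : L →ₗ[F] End F L := (LieAlgebra.ad F L : L →ₗ[F] End F L)
  let b := Module.Free.chooseBasis F L
  have hcoeff : ∀ (y : L) (i : ℕ), MvPolynomial.eval (b.repr y) ((φ.polyCharpoly b).coeff i) =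
      (LieAlgebra.ad F L y).charpoly.coeff i := by
    intro y i
    exact φ.polyCharpoly_coeff_eval b y i
  have hnil : ∀ y : L, IsNilpotent (LieAlgebra.ad F L y) ↔
      ∀ i < finrank F L, (LieAlgebra.ad F L y).charpoly.coeff i = 0 := by
    intro y
    rw [LinearMap.isNilpotent_iff_charpoly]
    constructor
    · intro h i hi
      rw [h, Polynomial.coeff_X_pow, if_neg hi.ne]
    · intro h
      have hm := (LieAlgebra.ad F L y).charpoly_monic
      have hn := (LieAlgebra.ad F L y).charpoly_natDegree
      ext i
      rw [Polynomial.coeff_X_pow]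
      split_ifs with hi
      · rw [hi, ← hn]
        exact hm
      · obtain hlt | hgt := lt_or_gt_of_ne hi
        · exact h i hlt
        · exact Polynomial.coeff_eq_zero_of_natDegree_lt (hn ▸ hgt)
  rw [hnil]
  intro i hi
  obtain rfl | hi0 := Nat.eq_zero_or_pos i
  · -- `x` lies in the kernel of `ad x`.
    have hx0 : x ≠ 0 := by
      rintro rfl
      exact hx (by rw [map_zero]; exact IsNilpotent.zero)
    have h := (LinearMap.hasEigenvalue_zero_tfae (LieAlgebra.ad F L x)).out 2 5
    rw [← Polynomial.constantCoeff_apply]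
    exact h.2 ⟨x, hx0, lie_self x⟩
  · obtain ⟨d, hd⟩ := Nat.exists_eq_add_of_le hi.le
    have hhom := φ.polyCharpoly_coeff_isHomogeneous b i d hd.symm
    rw [← hcoeff, ← coeff_aeval_linear hhom (b.repr v) (b.repr x)]
    have hzero : MvPolynomial.aeval (fun j => Polynomial.C (b.repr x j) * Polynomial.X +
        Polynomial.C (b.repr v j)) ((φ.polyCharpoly b).coeff i) = 0 := by
      apply Polynomial.eq_zero_of_forall_eval_zero_of_natDegree_lt_card
      · intro t
        have ht := (hnil _).1 (hall t) i hi
        have hfun : (fun j => b.repr x j * t + b.repr v j) = b.repr (v + t • x) := by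
          ext j
          simp [mul_comm t, add_comm]
        rw [← hcoeff, ← hfun] at ht
        rw [← ht, ← Polynomial.coe_evalRingHom, ← Polynomial.coe_aeval_eq_evalRingHom,
          RingHom.coe_coe, ← AlgHom.comp_apply, MvPolynomial.comp_aeval]
        simp only [map_add, map_mul, Polynomial.aeval_C, Polynomial.aeval_X,
          Algebra.algebraMap_self, RingHom.id_apply]
        exact DFunLike.congr_fun (MvPolynomial.coe_aeval_eq_eval _) _
      · refine lt_of_lt_of_le ?_ hF
        rw [Nat.cast_lt]
        have := natDegree_aeval_linear_le hhom (b.repr v) (b.repr x)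
        omega
    rw [hzero, Polynomial.coeff_zero]

end Pencil

/-! ### The filtration attached to a subalgebra -/

section Filtration

variable {F L : Type*} [Field F] [LieRing L] [LieAlgebra F L]

/-- The descending filtration `M = L₀ ⊇ L₁ ⊇ ⋯` of a Lie algebra attached to a subalgebra `M`,
where `Lₖ₊₁` consists of the `x ∈ Lₖ` with `[x, L] ⊆ Lₖ`. -/
def filtration (M : LieSubalgebra F L) : ℕ → Submodule F L
  | 0 => M.toSubmodule
  | k + 1 =>
    { carrier := {x | x ∈ filtration M k ∧ ∀ l : L, ⁅x, l⁆ ∈ filtration M k}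
      add_mem' := fun {a b} ha hb => ⟨Submodule.add_mem _ ha.1 hb.1, fun l => by
        rw [add_lie]
        exact Submodule.add_mem _ (ha.2 l) (hb.2 l)⟩
      zero_mem' := ⟨Submodule.zero_mem _, fun l => by
        rw [zero_lie]
        exact Submodule.zero_mem _⟩
      smul_mem' := fun c a ha => ⟨Submodule.smul_mem _ _ ha.1, fun l => by
        rw [smul_lie]
        exact Submodule.smul_mem _ _ (ha.2 l)⟩ }

variable {M : LieSubalgebra F L}

theorem filtration_antitone : Antitone (filtration M) :=
  antitone_nat_of_succ_le fun _ _ hx => hx.1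

theorem lie_mem_filtration (k : ℕ) :
    ∀ {x y : L}, x ∈ M → y ∈ filtration M k → ⁅x, y⁆ ∈ filtration M k := by
  induction k with
  | zero => intro x y hx hy; exact M.lie_mem hx hy
  | succ k ih =>
    intro x y hx hy
    refine ⟨ih hx hy.1, fun l => ?_⟩
    rw [lie_lie]
    exact Submodule.sub_mem _ (ih hx (hy.2 l)) (hy.2 _)

theorem lie_mem_filtration' {k : ℕ} {x y : L} (hx : x ∈ filtration M k) (hy : y ∈ M) :
    ⁅x, y⁆ ∈ filtration M k := by
  rw [← lie_skew]
  exact Submodule.neg_mem _ (lie_mem_filtration k hy hx)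

theorem lie_mem_filtration_succ (k : ℕ) :
    ∀ {x y : L}, x ∈ filtration M 1 → y ∈ filtration M k → ⁅x, y⁆ ∈ filtration M (k + 1) := by
  induction k with
  | zero => intro x y hx hy; exact lie_mem_filtration' hx hy
  | succ k ih =>
    intro x y hx hy
    refine ⟨lie_mem_filtration (k + 1) hx.1 hy, fun l => ?_⟩
    rw [lie_lie]
    exact Submodule.sub_mem _ (ih hx (hy.2 l)) (lie_mem_filtration' hy (hx.2 l))

theorem filtration_eq_bot_of_le_succ (hcore : core M = ⊥) {k : ℕ}
    (h : filtration M k ≤ filtration M (k + 1)) : filtration M k = ⊥ := by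
  let I : LieIdeal F L :=
    { filtration M k with
      lie_mem := fun {x m} hm => by
        rw [← lie_skew]
        exact Submodule.neg_mem _ ((h hm).2 x) }
  have hI : I ≤ core M := le_core fun x hx => filtration_antitone (Nat.zero_le k) hx
  rw [hcore, le_bot_iff] at hI
  exact (LieSubmodule.toSubmodule_eq_bot I).2 hI

variable [FiniteDimensional F L]

theorem exists_filtration_eq_bot (hcore : core M = ⊥) : ∃ n, filtration M n = ⊥ := by
  let d : ℕ → ℕ := fun k => finrank F (filtration M k)
  refine ⟨Function.argmin d, filtration_eq_bot_of_le_succ hcore ?_⟩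
  have h : d (Function.argmin d) ≤ d (Function.argmin d + 1) := Function.argmin_le d _
  exact (Submodule.eq_of_le_of_finrank_le (filtration_antitone (Nat.le_succ _)) h).ge

variable (hM : finrank F (L ⧸ M.toSubmodule) ≤ 1) {y : L} (hy : y ∉ M)
include hM hy

theorem lie_notMem_filtration {k : ℕ} {w : L} (hw : w ∈ filtration M k)
    (hw' : w ∉ filtration M (k + 1)) : ⁅w, y⁆ ∉ filtration M k := by
  intro h
  refine hw' ⟨hw, fun l => ?_⟩
  obtain ⟨c, hc⟩ := exists_sub_smul_mem hM (v := y) hy l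
  rw [← sub_add_cancel l (c • y), lie_add, lie_smul]
  exact Submodule.add_mem _ (lie_mem_filtration' hw hc) (Submodule.smul_mem _ _ h)

/-- The factors of the filtration attached to a subalgebra of codimension one are at most
one-dimensional: `ad y` embeds each in the preceding one, and the first in `L ⧸ M`. -/
theorem exists_sub_smul_mem_filtration (k : ℕ) :
    ∀ {e w : L}, e ∈ filtration M k → e ∉ filtration M (k + 1) → w ∈ filtration M k →
      ∃ c : F, w - c • e ∈ filtration M (k + 1) := by
  have key : ∀ k : ℕ, ∀ {e w : L} {c : F}, e ∈ filtration M k → w ∈ filtration M k →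
      ⁅w, y⁆ - c • ⁅e, y⁆ ∈ filtration M k → w - c • e ∈ filtration M (k + 1) := by
    intro k e w c he hw h
    by_contra hn
    refine lie_notMem_filtration hM hy (Submodule.sub_mem _ hw (Submodule.smul_mem _ c he)) hn ?_
    rwa [sub_lie, smul_lie]
  induction k with
  | zero =>
    intro e w he he' hw
    obtain ⟨c, hc⟩ := exists_sub_smul_mem hM (lie_notMem_filtration hM hy he he') ⁅w, y⁆
    exact ⟨c, key 0 he hw hc⟩
  | succ k ih =>
    intro e w he he' hw
    obtain ⟨c, hc⟩ := ih (he.2 y) (lie_notMem_filtration hM hy he he') (hw.2 y)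
    exact ⟨c, key (k + 1) he hw hc⟩

end Filtration

/-! ### Small Lie algebras -/

section Small

variable {F L : Type*} [Field F] [LieRing L] [LieAlgebra F L]

theorem isSolvable_of_span_pair {a b : L} (h : ∀ l : L, ∃ s t : F, l = s • a + t • b) :
    LieAlgebra.IsSolvable L := by
  have hlie : ∀ l l' : L, ∃ c : F, ⁅l, l'⁆ = c • ⁅a, b⁆ := by
    intro l l'
    obtain ⟨s, t, rfl⟩ := h l
    obtain ⟨s', t', rfl⟩ := h l'
    refine ⟨s * t' - t * s', ?_⟩
    simp only [add_lie, lie_add, smul_lie, lie_smul, lie_self, ← lie_skew a b]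
    module
  have h1 : ∀ x ∈ LieAlgebra.derivedSeries F L 1, ∃ c : F, x = c • ⁅a, b⁆ := by
    intro x hx
    rw [LieAlgebra.derivedSeries_def, LieAlgebra.derivedSeriesOfIdeal_succ,
      LieAlgebra.derivedSeriesOfIdeal_zero, ← LieSubmodule.mem_toSubmodule,
      LieSubmodule.lieIdeal_oper_eq_linear_span'] at hx
    have hle : Submodule.span F {m : L | ∃ x ∈ (⊤ : LieIdeal F L), ∃ n ∈ (⊤ : LieIdeal F L),
        ⁅x, n⁆ = m} ≤ Submodule.span F {⁅a, b⁆} := by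
      rw [Submodule.span_le]
      rintro _ ⟨l, -, l', -, rfl⟩
      obtain ⟨c, hc⟩ := hlie l l'
      exact Submodule.mem_span_singleton.2 ⟨c, hc.symm⟩
    obtain ⟨c, hc⟩ := Submodule.mem_span_singleton.1 (hle hx)
    exact ⟨c, hc.symm⟩
  refine LieAlgebra.IsSolvable.mk (R := F) (k := 2) (le_bot_iff.1 ?_)
  rw [LieAlgebra.derivedSeries_def, LieAlgebra.derivedSeriesOfIdeal_succ,
    LieSubmodule.lieIdeal_oper_eq_span, LieSubmodule.lieSpan_le]
  rintro _ ⟨⟨x, hx⟩, ⟨x', hx'⟩, rfl⟩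
  obtain ⟨c, rfl⟩ := h1 x hx
  obtain ⟨c', rfl⟩ := h1 x' hx'
  simp

theorem nonempty_lieEquiv_lOneZero {p q r : L} (hpq : ⁅p, q⁆ = p) (hpr : ⁅p, r⁆ = q)
    (hqr : ⁅q, r⁆ = r) (hr : r ≠ 0) (hspan : ∀ l : L, ∃ s t v : F, l = s • p + t • q + v • r) :
    Nonempty (L ≃ₗ⁅F⁆ LOneZero F) := by
  have hqp : ⁅q, p⁆ = -p := by rw [← lie_skew, hpq]
  have hrp : ⁅r, p⁆ = -q := by rw [← lie_skew, hpr]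
  have hrq : ⁅r, q⁆ = -r := by rw [← lie_skew, hqr]
  let f : LOneZero F →ₗ⁅F⁆ L :=
    { toFun := fun x => x 0 • p + x 1 • q + x 2 • r
      map_add' := fun x x' => by
        simp only [LOneZero.add_apply]
        module
      map_smul' := fun c x => by
        simp only [LOneZero.smul_apply, RingHom.id_apply]
        module
      map_lie' := fun {x x'} => by
        simp only [LOneZero.bracket_zero, LOneZero.bracket_one, LOneZero.bracket_two, add_lie,
          lie_add, smul_lie, lie_smul, lie_self, hpq, hpr, hqr, hqp, hrp, hrq]
        module }
  have hf : ∀ x, f x = x 0 • p + x 1 • q + x 2 • r := fun _ => rfl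
  have hinj : Function.Injective f := by
    rw [injective_iff_map_eq_zero]
    intro x hx
    rw [hf] at hx
    have h1 : x 0 • q + x 1 • r = 0 := by
      have := congrArg (fun l => ⁅l, r⁆) hx
      simpa [hpr, hqr] using this
    have h2 : x 0 = 0 := by
      have := congrArg (fun l => ⁅l, r⁆) h1
      simpa [hqr, hr] using this
    have h3 : x 1 = 0 := by simpa [h2, hr] using h1
    have h4 : x 2 = 0 := by simpa [h2, h3, hr] using hx
    exact LOneZero.ext_coord h2 h3 h4
  have hsurj : Function.Surjective f := by
    intro l
    obtain ⟨s, t, v, rfl⟩ := hspan l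
    exact ⟨LOneZero.mk s t v, rfl⟩
  exact ⟨(LieEquiv.ofBijective f ⟨hinj, hsurj⟩).symm⟩

end Small

/-! ### Two subalgebras of codimension one -/

section TwoSubalgebras

variable {F L : Type*} [Field F] [LieRing L] [LieAlgebra F L] [FiniteDimensional F L]
  {M M' : LieSubalgebra F L} (hM : finrank F (L ⧸ M.toSubmodule) ≤ 1)
  (hM' : finrank F (L ⧸ M'.toSubmodule) ≤ 1) (hG : M' ∈ setG F L) {y : L} (hy : y ∉ M)
  (hyM' : y ∈ M') {m : ℕ}
  (hlt : ∀ k ≤ m, ¬ filtration M k ≤ filtration M (k + 1))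
include hM hM' hG hy hyM' hlt

omit hM' in
/-- The last nonzero term of the filtration is not contained in the second subalgebra, because
`ad y` recovers the rest of `L` from it. -/
theorem exists_mem_filtration_notMem : ∃ z ∈ filtration M m, z ∉ M' := by
  by_contra! hle
  have key : ∀ j ≤ m, ∀ z ∈ filtration M (m - j), z ∈ M' := by
    intro j
    induction j with
    | zero => intro _; exact hle
    | succ j ih =>
      intro hj
      have ih := ih (by omega)
      obtain ⟨k, hk⟩ : ∃ k, m - j = k + 1 := ⟨m - (j + 1), by omega⟩
      rw [hk] at ih
      rw [show m - (j + 1) = k by omega]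
      obtain ⟨e, he, he'⟩ := SetLike.not_le_iff_exists.1 (hlt (k + 1) (by omega))
      intro w hw
      obtain ⟨c, hc⟩ := exists_sub_smul_mem_filtration hM hy k (he.2 y)
        (lie_notMem_filtration hM hy he he') hw
      rw [← sub_add_cancel w (c • ⁅e, y⁆)]
      exact M'.add_mem (ih _ hc) (M'.smul_mem _ (M'.lie_mem (ih _ he) hyM'))
  refine hG.1.1 (eq_top_iff.2 fun l _ => ?_)
  obtain ⟨c, hc⟩ := exists_sub_smul_mem hM (v := y) hy l
  rw [← sub_add_cancel l (c • y)]
  refine M'.add_mem (key m le_rfl _ ?_) (M'.smul_mem _ hyM')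
  rw [Nat.sub_self]
  exact hc

variable (hbot : filtration M (m + 1) = ⊥) {z : L} (hz : z ∈ filtration M m) (hzM' : z ∉ M')
include hbot hz hzM'

omit hM' hG hlt hyM' in
theorem eq_zero_of_mem_filtration_of_mem {w : L} (hw : w ∈ filtration M m) (hwM' : w ∈ M') :
    w = 0 := by
  have hz' : z ∉ filtration M (m + 1) := by
    rw [hbot, Submodule.mem_bot]
    rintro rfl
    exact hzM' M'.zero_mem
  obtain ⟨c, hc⟩ := exists_sub_smul_mem_filtration hM hy m hz hz' hw
  rw [hbot, Submodule.mem_bot, sub_eq_zero] at hc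
  obtain rfl | hc0 := eq_or_ne c 0
  · rw [hc, zero_smul]
  · rw [hc] at hwM'
    refine absurd ?_ hzM'
    have := M'.smul_mem c⁻¹ hwM'
    rwa [smul_smul, inv_mul_cancel₀ hc0, one_smul] at this

omit hM hG hy hyM' hlt hbot in
theorem exists_mem_filtration_inf (k : ℕ) (hk : k < m)
    (h : ¬ filtration M k ≤ filtration M (k + 1)) :
    ∃ w ∈ filtration M k, w ∉ filtration M (k + 1) ∧ w ∈ M' := by
  obtain ⟨w, hw, hw'⟩ := SetLike.not_le_iff_exists.1 h
  obtain ⟨c, hc⟩ := exists_sub_smul_mem hM' hzM' w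
  refine ⟨w - c • z, Submodule.sub_mem _ hw (Submodule.smul_mem _ _ ?_), fun hn => hw' ?_, hc⟩
  · exact filtration_antitone hk.le hz
  · rw [← sub_add_cancel w (c • z)]
    exact Submodule.add_mem _ hn (Submodule.smul_mem _ _ (filtration_antitone hk hz))

omit hyM' hlt in
/-- An element `u` of `M ∩ M'` of filtration degree zero cannot annihilate the last term of the
filtration, spanned by `z`. Otherwise all of `M` annihilates `z`, and the Jacobi identity for `u`,
`y`, `z` gives `[y, z] ∈ M'`; hence `z` normalizes `M'`, whereas subalgebras containing an Engel
subalgebra are self-normalizing. -/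
theorem lie_ne_zero_of_notMem_filtration {u : L} (hu : u ∈ M) (huM' : u ∈ M')
    (hu1 : u ∉ filtration M 1) : ⁅u, z⁆ ≠ 0 := by
  intro huz
  have hkz : ∀ k ∈ M, ⁅k, z⁆ = 0 := by
    intro k hk
    obtain ⟨c, hc⟩ := exists_sub_smul_mem_filtration hM hy 0 hu hu1 hk
    have h := lie_mem_filtration_succ m hc hz
    rw [hbot, Submodule.mem_bot, sub_lie, smul_lie, huz, smul_zero, sub_zero] at h
    exact h
  have huL : ∀ l, ⁅u, l⁆ ∈ M' := by
    intro l
    obtain ⟨c, hc⟩ := exists_sub_smul_mem hM' hzM' l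
    have h := M'.lie_mem huM' hc
    rwa [lie_sub, lie_smul, huz, smul_zero, sub_zero] at h
  have huy : ⁅u, y⁆ ∉ M := lie_notMem_filtration hM hy (k := 0) hu hu1
  obtain ⟨d, hd⟩ := exists_sub_smul_mem hM (v := y) hy ⁅u, y⁆
  have hd0 : d ≠ 0 := by
    rintro rfl
    rw [zero_smul, sub_zero] at hd
    exact huy hd
  have hyz : ⁅y, z⁆ ∈ M' := by
    have h1 : ⁅⁅u, y⁆, z⁆ = ⁅u, ⁅y, z⁆⁆ := by rw [lie_lie, huz, lie_zero, sub_zero]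
    have h2 := hkz _ hd
    rw [sub_lie, smul_lie, h1, sub_eq_zero] at h2
    have h3 := M'.smul_mem d⁻¹ (huL ⁅y, z⁆)
    rwa [h2, smul_smul, inv_mul_cancel₀ hd0, one_smul] at h3
  have hpz : ∀ p ∈ M', ⁅p, z⁆ ∈ M' := by
    intro p _
    obtain ⟨c, hc⟩ := exists_sub_smul_mem hM (v := y) hy p
    have h := hkz _ hc
    rw [sub_lie, smul_lie, sub_eq_zero] at h
    rw [h]
    exact M'.smul_mem _ hyz
  obtain ⟨hco, x, hx⟩ := hG
  refine hzM' ?_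
  rw [← LieSubalgebra.normalizer_eq_self_of_engel_le M' x hx, LieSubalgebra.mem_normalizer_iff']
  exact hpz

/-- The filtration has at most two nonzero terms. -/
theorem length_filtration_le : m ≤ 1 := by
  by_contra! hm
  obtain ⟨k, rfl⟩ : ∃ k, m = k + 1 := ⟨m - 1, by omega⟩
  obtain ⟨w₁, hw₁, hw₁', hw₁M'⟩ :=
    exists_mem_filtration_inf hM' hz hzM' 1 hm (hlt 1 hm.le)
  obtain ⟨w, hw, hw', hwM'⟩ :=
    exists_mem_filtration_inf hM' hz hzM' k (Nat.lt_succ_self k) (hlt k (Nat.le_succ k))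
  have h1 : ⁅w₁, w⁆ = 0 := eq_zero_of_mem_filtration_of_mem hM hy hbot hz hzM'
    (lie_mem_filtration_succ k hw₁ hw) (M'.lie_mem hw₁M' hwM')
  have h2 : ∀ v ∈ filtration M (k + 1), ⁅w₁, v⁆ = 0 := by
    intro v hv
    have := lie_mem_filtration_succ (k + 1) hw₁ hv
    rwa [hbot, Submodule.mem_bot] at this
  refine lie_ne_zero_of_notMem_filtration hM hM' hG hy hbot hz hzM' (u := ⁅w₁, y⁆)
    (hw₁.2 y) (M'.lie_mem hw₁M' hyM') (lie_notMem_filtration hM hy hw₁ hw₁') ?_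
  obtain ⟨c, hc⟩ := exists_sub_smul_mem_filtration hM hy k hw hw' (hz.2 y)
  have h3 : ⁅w₁, ⁅y, z⁆⁆ = 0 := by
    have := h2 _ hc
    rw [lie_sub, lie_smul, h1, smul_zero, sub_zero] at this
    rw [← lie_skew y z, lie_neg, this, neg_zero]
  rw [lie_lie, h3, h2 z hz, lie_zero, sub_zero]

omit hG in
theorem nonempty_lieEquiv_of_eq_one (hm : m = 1) : Nonempty (L ≃ₗ⁅F⁆ LOneZero F) := by
  subst hm
  obtain ⟨u, hu, hu1, huM'⟩ :=
    exists_mem_filtration_inf hM' hz hzM' 0 Nat.zero_lt_one (hlt 0 (Nat.zero_le 1))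
  have huM : u ∈ M := hu
  have hz2 : z ∉ filtration M 2 := by
    rw [hbot, Submodule.mem_bot]
    rintro rfl
    exact hzM' M'.zero_mem
  have hV1 : ∀ w ∈ filtration M 1, ∃ c : F, w = c • z := by
    intro w hw
    obtain ⟨c, hc⟩ := exists_sub_smul_mem_filtration hM hy 1 hz hz2 hw
    rw [hbot, Submodule.mem_bot, sub_eq_zero] at hc
    exact ⟨c, hc⟩
  have hMspan : ∀ k ∈ M, ∃ s t : F, k = s • u + t • z := by
    intro k hk
    obtain ⟨s, hs⟩ := exists_sub_smul_mem_filtration hM hy 0 hu hu1 hk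
    obtain ⟨t, ht⟩ := hV1 _ hs
    exact ⟨s, t, by rw [← ht, add_sub_cancel]⟩
  have hMM' : ∀ k ∈ M, k ∈ M' → ∃ s : F, k = s • u := by
    intro k hk hk'
    obtain ⟨s, hs⟩ := exists_sub_smul_mem_filtration hM hy 0 hu hu1 hk
    refine ⟨s, sub_eq_zero.1 (eq_zero_of_mem_filtration_of_mem hM hy hbot hz hzM' hs ?_)⟩
    exact M'.sub_mem hk' (M'.smul_mem _ huM')
  obtain ⟨c, hc⟩ := hV1 _ (lie_mem_filtration 1 huM hz)
  obtain ⟨α, hα⟩ := exists_sub_smul_mem hM (v := y) hy ⁅y, u⁆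
  obtain ⟨β, hβ⟩ := hMM' _ hα (M'.sub_mem (M'.lie_mem hyM' huM') (M'.smul_mem _ hyM'))
  have hα0 : α ≠ 0 := by
    rintro rfl
    rw [zero_smul, sub_zero] at hα
    refine lie_notMem_filtration hM hy hu hu1 ?_
    rw [← lie_skew]
    exact Submodule.neg_mem _ hα
  -- `y` and `u` are modified within `M'` so that `[p, q] = p`.
  obtain ⟨q, hq⟩ : ∃ q, q = α⁻¹ • u := ⟨_, rfl⟩
  obtain ⟨p, hp⟩ : ∃ p, p = y + β • q := ⟨_, rfl⟩
  have huq : u = α • q := by rw [hq, smul_smul, mul_inv_cancel₀ hα0, one_smul]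
  have hpq : ⁅p, q⁆ = p := by
    have h1 : ⁅y, q⁆ = y + β • q := by
      rw [sub_eq_iff_eq_add] at hβ
      rw [hq, lie_smul, hβ, smul_add, smul_smul α⁻¹ α, inv_mul_cancel₀ hα0, one_smul,
        smul_comm, add_comm]
    rw [hp, add_lie, smul_lie, lie_self, smul_zero, add_zero, h1]
  have hpM : p ∉ M := by
    intro h
    rw [hp] at h
    refine hy ?_
    have := M.sub_mem h (M.smul_mem β (hq ▸ M.smul_mem α⁻¹ huM : q ∈ M))
    rwa [add_sub_cancel_right] at this
  obtain ⟨s, t, hst⟩ := hMspan _ (by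
    rw [← lie_skew]
    exact M.neg_mem (hz.2 p) : ⁅p, z⁆ ∈ M)
  obtain ⟨a, ha⟩ : ∃ a, a = s * α := ⟨_, rfl⟩
  obtain ⟨d, hd⟩ : ∃ d, d = α⁻¹ * c := ⟨_, rfl⟩
  have hpz : ⁅p, z⁆ = a • q + t • z := by rw [hst, huq, smul_smul, ha]
  have hqz : ⁅q, z⁆ = d • z := by rw [hq, smul_lie, hc, smul_smul, hd]
  have ha0 : a ≠ 0 := by
    rintro ha0
    refine lie_notMem_filtration hM hpM hz hz2 ?_
    rw [← lie_skew, hpz, ha0, zero_smul, zero_add]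
    exact Submodule.neg_mem _ (Submodule.smul_mem _ _ hz)
  -- The Jacobi identity for `p`, `q`, `z`.
  have hJ : (d * a) • q + (d * t) • z = a • q + (t + t * d) • z := by
    have h := leibniz_lie p q z
    rw [hqz, lie_smul, hpq, hpz, lie_add, lie_smul, lie_smul, lie_self, hqz, smul_zero,
      zero_add] at h
    rw [smul_add, smul_smul, smul_smul, smul_smul] at h
    rw [h, add_smul, add_assoc]
  have hz0 : z ≠ 0 := by
    rintro rfl
    exact hzM' M'.zero_mem
  have hqM' : q ∈ M' := hq ▸ M'.smul_mem α⁻¹ huM'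
  have ht0 : t = 0 := by
    by_contra ht0
    refine hzM' ?_
    have h1 : t • z = (d * a - a) • q := by
      have : (d * t) • z = (t * d) • z := by rw [mul_comm]
      rw [sub_smul, eq_sub_iff_add_eq, add_comm]
      rw [add_smul, this, ← add_assoc] at hJ
      exact (add_right_cancel hJ).symm
    have h2 := M'.smul_mem t⁻¹ (M'.smul_mem (d * a - a) hqM')
    rwa [← h1, smul_smul, inv_mul_cancel₀ ht0, one_smul] at h2
  subst ht0
  have hd1 : d = 1 := by
    rw [mul_zero, zero_mul, add_zero, zero_smul, add_zero, add_zero] at hJ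
    have hq0 : q ≠ 0 := by
      intro h0
      rw [h0, lie_zero] at hpq
      exact hpM (hpq ▸ M.zero_mem)
    have := smul_left_injective F hq0 hJ
    exact mul_right_cancel₀ ha0 (this.trans (one_mul a).symm)
  rw [zero_smul, add_zero] at hpz
  rw [hd1, one_smul] at hqz
  refine nonempty_lieEquiv_lOneZero (p := p) (q := q) (r := a⁻¹ • z) hpq ?_ ?_ ?_ ?_
  · rw [lie_smul, hpz, smul_smul, inv_mul_cancel₀ ha0, one_smul]
  · rw [lie_smul, hqz]
  · exact smul_ne_zero (inv_ne_zero ha0) hz0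
  · intro l
    obtain ⟨e, he⟩ := exists_sub_smul_mem hM (v := p) hpM l
    obtain ⟨s', t', h'⟩ := hMspan _ he
    refine ⟨e, s' * α, t' * a, ?_⟩
    rw [← sub_add_cancel l (e • p), h', huq, smul_smul, smul_smul, mul_assoc,
      mul_inv_cancel₀ ha0, mul_one]
    abel

end TwoSubalgebras

/-! ### Core-free subalgebras of codimension one -/

section CoreFree

variable {F L : Type*} [Field F] [LieRing L] [LieAlgebra F L] [FiniteDimensional F L]

/-- A non-solvable Lie algebra with a core-free subalgebra of codimension one is `L₁(0)`, provided
that all maximal subalgebras containing an Engel subalgebra have codimension one. -/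
theorem nonempty_lieEquiv_of_core_eq_bot (hF : (finrank F L : Cardinal) ≤ Cardinal.mk F)
    (hC : MaxEngelCodimOne F L) (hsol : ¬ LieAlgebra.IsSolvable L) {M : LieSubalgebra F L}
    (hM : finrank F (L ⧸ M.toSubmodule) ≤ 1) (htop : M ≠ ⊤) (hcore : core M = ⊥) :
    Nonempty (L ≃ₗ⁅F⁆ LOneZero F) := by
  classical
  obtain ⟨v, hv⟩ : ∃ v, v ∉ M := by
    by_contra! h
    exact htop (eq_top_iff.2 fun x _ => h x)
  -- `n` is the number of nonzero terms of the filtration.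
  have hex := exists_filtration_eq_bot hcore
  obtain ⟨n, hn, hmin⟩ : ∃ n, filtration M n = ⊥ ∧ ∀ k < n, filtration M k ≠ ⊥ :=
    ⟨Nat.find hex, Nat.find_spec hex, fun k hk => Nat.find_min hex hk⟩
  have hn2 : 2 ≤ n := by
    by_contra! hlt
    have h1 : filtration M 1 = ⊥ :=
      le_bot_iff.1 ((filtration_antitone (by omega : n ≤ 1)).trans hn.le)
    apply hsol
    by_cases hM0 : ∀ x ∈ M, x = 0
    · refine isSolvable_of_span_pair (F := F) (a := v) (b := 0) fun l => ?_
      obtain ⟨c, hc⟩ := exists_sub_smul_mem hM (v := v) hv l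
      exact ⟨c, 0, by rw [smul_zero, add_zero]; exact sub_eq_zero.1 (hM0 _ hc)⟩
    · push Not at hM0
      obtain ⟨e, he, he0⟩ := hM0
      have he1 : e ∉ filtration M 1 := by rwa [h1, Submodule.mem_bot]
      refine isSolvable_of_span_pair (F := F) (a := v) (b := e) fun l => ?_
      obtain ⟨c, hc⟩ := exists_sub_smul_mem hM (v := v) hv l
      obtain ⟨s, hs⟩ := exists_sub_smul_mem_filtration hM hv 0 he he1 hc
      rw [h1, Submodule.mem_bot, sub_sub, sub_eq_zero] at hs
      exact ⟨c, s, hs⟩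
  obtain ⟨m, rfl⟩ : ∃ m, n = m + 1 := ⟨n - 1, by omega⟩
  have hlt : ∀ k ≤ m, ¬ filtration M k ≤ filtration M (k + 1) := fun k hk h =>
    hmin k (by omega) (filtration_eq_bot_of_le_succ hcore h)
  -- Some `x ∈ M` acts on the line `L ⧸ M` by a nonzero scalar, so `ad x` is not nilpotent.
  obtain ⟨x, hx, hx1⟩ := SetLike.not_le_iff_exists.1 (hlt 0 (Nat.zero_le m))
  have hxnil : ¬ IsNilpotent (LieAlgebra.ad F L x) := by
    rintro ⟨j, hj⟩
    have hstep : ∀ l : L, l ∉ M → ⁅x, l⁆ ∉ M := fun l hl =>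
      lie_notMem_filtration hM hl (k := 0) hx hx1
    have hall : ∀ i, (LieAlgebra.ad F L x ^ i) v ∉ M := by
      intro i
      induction i with
      | zero => exact hv
      | succ i ih =>
        rw [pow_succ', Module.End.mul_apply]
        exact hstep _ ih
    apply hall j
    rw [hj]
    exact M.zero_mem
  obtain ⟨t, ht⟩ := exists_not_isNilpotent_ad_add_smul hF hxnil v
  have hyM : v + t • x ∉ M := by
    intro h
    apply hv
    have := M.sub_mem h (M.smul_mem t hx)
    rwa [add_sub_cancel_right] at this
  obtain ⟨M', hG, hle⟩ := exists_mem_setG_of_engel_ne_top (mt isNilpotent_ad_of_engel_eq_top ht)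
  have hyM' : v + t • x ∈ M' := hle (LieSubalgebra.self_mem_engel F _)
  obtain ⟨z, hz, hzM'⟩ := exists_mem_filtration_notMem hM hG hyM hyM' hlt
  have hm := length_filtration_le hM (hC M' hG) hG hyM hyM' hlt hn hz hzM'
  exact nonempty_lieEquiv_of_eq_one hM (hC M' hG) hyM hyM' hlt hn hz hzM' (by omega)

end CoreFree

/-! ### Simplicity of `L₁(0)` -/

section Simple

variable {F : Type*} [Field F]

namespace LOneZero

omit [Field F] in
theorem mk_apply_zero (a b c : F) : mk a b c 0 = a := rfl

omit [Field F] in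
theorem mk_apply_one (a b c : F) : mk a b c 1 = b := rfl

omit [Field F] in
theorem mk_apply_two (a b c : F) : mk a b c 2 = c := rfl

theorem mk_zero_zero_one_mem {J : LieIdeal F (LOneZero F)} (hJ : J ≠ ⊥) : mk 0 0 1 ∈ J := by
  obtain ⟨x, hx, hx0⟩ := J.toSubmodule.ne_bot_iff.1 (mt (LieSubmodule.toSubmodule_eq_bot J).1 hJ)
  have key : ∀ (c : F) (w : LOneZero F), w ∈ J → c ≠ 0 → w = c • mk 0 0 1 → mk 0 0 1 ∈ J := by
    intro c w hw hc hwc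
    have := J.smul_mem c⁻¹ hw
    rwa [hwc, smul_smul, inv_mul_cancel₀ hc, one_smul] at this
  have h1 : ⁅x, mk 0 0 1⁆ ∈ J := lie_mem_left F _ J _ _ hx
  by_cases h0 : x 0 = 0
  · by_cases h2 : x 1 = 0
    · refine key (x 2) x hx ?_ ?_
      · intro h3
        exact hx0 (ext_coord h0 h2 h3)
      · apply ext_coord <;> simp [smul_apply, mk_apply_zero, mk_apply_one, mk_apply_two, h0, h2]
    · refine key (x 1) _ h1 h2 ?_
      apply ext_coord <;>
        simp [smul_apply, mk_apply_zero, mk_apply_one, mk_apply_two, h0,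
          bracket_zero, bracket_one, bracket_two]
  · refine key (x 0) _ (lie_mem_left F _ J _ (mk 0 0 1) h1) h0 ?_
    apply ext_coord <;>
      simp [smul_apply, mk_apply_zero, mk_apply_one, mk_apply_two, bracket_zero,
        bracket_one, bracket_two]

/-- The Lie algebra `L₁(0)` is simple. -/
theorem eq_top_of_ne_bot {J : LieIdeal F (LOneZero F)} (hJ : J ≠ ⊥) : J = ⊤ := by
  have h1 := mk_zero_zero_one_mem hJ
  have h0 : mk 0 1 0 ∈ J := by
    have := lie_mem_right F _ J (mk 1 0 0) _ h1
    refine (congrArg (· ∈ J) ?_).mp this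
    apply ext_coord <;>
      simp [mk_apply_zero, mk_apply_one, mk_apply_two, bracket_zero, bracket_one, bracket_two]
  have h2 : mk 1 0 0 ∈ J := by
    have := lie_mem_right F _ J (mk 1 0 0) _ h0
    refine (congrArg (· ∈ J) ?_).mp this
    apply ext_coord <;>
      simp [mk_apply_zero, mk_apply_one, mk_apply_two, bracket_zero, bracket_one, bracket_two]
  refine eq_top_iff.2 fun x _ => ?_
  have := J.add_mem (J.add_mem (J.smul_mem (x 0) h2) (J.smul_mem (x 1) h0)) (J.smul_mem (x 2) h1)
  suffices h : x = x 0 • mk 1 0 0 + x 1 • mk 0 1 0 + x 2 • mk 0 0 1 by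
    rw [h]
    exact this
  apply ext_coord <;> simp [mk_apply_zero, mk_apply_one, mk_apply_two, add_apply, smul_apply]

theorem not_isSolvable : ¬ LieAlgebra.IsSolvable (LOneZero F) := by
  intro h
  have h1 : mk 0 0 1 ≠ (0 : LOneZero F) := fun h => one_ne_zero (α := F) (congrFun h 2)
  have : Nontrivial (LOneZero F) := ⟨⟨_, _, h1⟩⟩
  refine (LieAlgebra.derivedSeries_lt_top_of_solvable F (LOneZero F)).ne (eq_top_of_ne_bot ?_)
  intro hbot
  have hmem : ⁅(mk 0 1 0 : LOneZero F), (mk 0 0 1 : LOneZero F)⁆ ∈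
      LieAlgebra.derivedSeries F (LOneZero F) 1 := by
    rw [LieAlgebra.derivedSeries_def, LieAlgebra.derivedSeriesOfIdeal_succ]
    exact LieSubmodule.lie_mem_lie (I := ⊤) (N := ⊤) (LieSubmodule.mem_top _)
      (LieSubmodule.mem_top _)
  rw [hbot, LieSubmodule.mem_bot] at hmem
  have := congrFun hmem 2
  simp [mk_apply_one, mk_apply_two, bracket_two, zero_apply] at this

end LOneZero

end Simple

/-! ### The non-solvable case -/

section NonSolvable

variable {F L : Type*} [Field F] [LieRing L] [LieAlgebra F L] [FiniteDimensional F L]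

/-- The core-free subalgebra `M / M_L` of `L ⧸ M_L` has codimension one. -/
theorem nonempty_quotient_core_lieEquiv (hF : (finrank F L : Cardinal) ≤ Cardinal.mk F)
    (hC : MaxEngelCodimOne F L) {M : LieSubalgebra F L} (hG : M ∈ setG F L)
    (hsol : ¬ LieAlgebra.IsSolvable (L ⧸ core M)) : Nonempty ((L ⧸ core M) ≃ₗ⁅F⁆ LOneZero F) := by
  have : FiniteDimensional F (L ⧸ core M) :=
    inferInstanceAs (FiniteDimensional F (L ⧸ (core M).toSubmodule))
  have hsurj := quotientHom_surjective (core M)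
  have hmem : ∀ x, quotientHom (core M) x ∈ M.map (quotientHom (core M)) → x ∈ M := by
    intro x hx
    obtain ⟨x', hx', he⟩ := (LieSubalgebra.mem_map _ _ _).1 hx
    have : x - x' ∈ M := core_le (quotientHom_eq_zero.1 (by rw [map_sub, he, sub_self]))
    rw [← sub_add_cancel x x']
    exact M.add_mem this hx'
  refine nonempty_lieEquiv_of_core_eq_bot ?_ (hC.of_surjective hsurj) hsol
    (M := M.map (quotientHom (core M))) ?_ ?_ ?_
  · refine le_trans (Nat.cast_le.2 ?_) hF
    have := finrank_quotient_add (core M)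
    omega
  · let g : (L ⧸ M.toSubmodule) →ₗ[F] (L ⧸ core M) ⧸ (M.map (quotientHom (core M))).toSubmodule :=
      Submodule.mapQ _ _ (quotientHom (core M) : L →ₗ[F] L ⧸ core M) fun x hx =>
        (LieSubalgebra.mem_map _ _ _).2 ⟨x, hx, rfl⟩
    have hg : Function.Surjective g := by
      intro w
      obtain ⟨w, rfl⟩ := Submodule.mkQ_surjective _ w
      obtain ⟨x, rfl⟩ := hsurj w
      exact ⟨Submodule.mkQ _ x, rfl⟩
    exact (LinearMap.finrank_le_finrank_of_surjective hg).trans (hC M hG)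
  · intro htop
    exact hG.1.1 (eq_top_iff.2 fun x _ => hmem x (htop ▸ LieSubalgebra.mem_top _))
  · rw [eq_bot_iff]
    intro w hw
    obtain ⟨x, rfl⟩ := hsurj w
    have hle : (core (M.map (quotientHom (core M)))).comap (quotientHom (core M)) ≤ core M :=
      le_core fun y hy => hmem y (core_le hy)
    rw [LieSubmodule.mem_bot, quotientHom_eq_zero]
    exact hle hw

/-- If `L` is not solvable, a minimal ideal of `L ⧸ γ(L)` below the last term of the derived series
is isomorphic to `L₁(0)`. -/
theorem exists_ideal_lieEquiv (hF : (finrank F L : Cardinal) ≤ Cardinal.mk F)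
    (hC : MaxEngelCodimOne F L) (hsol : ¬ LieAlgebra.IsSolvable L) :
    ∃ I : LieIdeal F (L ⧸ gamma F L), Nonempty (I ≃ₗ⁅F⁆ LOneZero F) := by
  have hγ : ¬ LieAlgebra.IsSolvable (L ⧸ gamma F L) := by
    intro h
    have := isSolvable_gamma (F := F) (L := L)
    exact hsol (isSolvable_of_quotient (gamma F L))
  -- `R` is the last term of the derived series, the smallest ideal with solvable quotient.
  obtain ⟨R, hRγ, hR⟩ : ∃ R : LieIdeal F L, ¬ R ≤ gamma F L ∧
      ∀ K : LieIdeal F L, LieAlgebra.IsSolvable (L ⧸ K) → R ≤ K := by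
    let d : ℕ → ℕ := fun k => finrank F (LieAlgebra.derivedSeries F L k)
    refine ⟨LieAlgebra.derivedSeries F L (Function.argmin d), fun hle =>
      hγ (derivedSeries_le_iff_isSolvable_quotient.1 ⟨_, hle⟩), fun K hK => ?_⟩
    obtain ⟨j, hj⟩ := derivedSeries_le_iff_isSolvable_quotient.2 hK
    have hanti : ∀ {i k : ℕ}, i ≤ k →
        LieAlgebra.derivedSeries F L k ≤ LieAlgebra.derivedSeries F L i :=
      fun h => LieAlgebra.derivedSeriesOfIdeal_antitone _ h
    have heq := Submodule.eq_of_le_of_finrank_le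
      (hanti (le_max_left (Function.argmin d) j) :
        (LieAlgebra.derivedSeries F L (max (Function.argmin d) j)).toSubmodule ≤
          (LieAlgebra.derivedSeries F L (Function.argmin d)).toSubmodule)
      (Function.argmin_le d _)
    exact heq.ge.trans ((hanti (le_max_right _ _)).trans hj)
  have : WellFoundedLT (LieIdeal F L) := LieSubmodule.wellFoundedLT_of_isArtinian F L L
  obtain ⟨J, hcov, hJ⟩ := exists_covBy_le_of_lt (left_lt_sup.2 hRγ)
  obtain ⟨M, hG, hJM⟩ : ∃ M ∈ setG F L, ¬ J ≤ core M := by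
    by_contra! h
    exact hcov.lt.not_ge fun x hx => mem_gamma_iff.2 fun M hM => h M hM hx
  have hγM : gamma F L ≤ core M := fun x hx => mem_gamma_iff.1 hx M hG
  obtain ⟨e⟩ := nonempty_quotient_core_lieEquiv hF hC hG fun h =>
    hJM (hJ.trans (sup_le hγM (hR _ h)))
  have hinf : J ⊓ core M = gamma F L :=
    (hcov.eq_or_eq (le_inf hcov.le hγM) inf_le_left).resolve_right fun h => hJM (inf_eq_left.1 h)
  let f : L →ₗ⁅F⁆ LOneZero F := (e : (L ⧸ core M) →ₗ⁅F⁆ LOneZero F).comp (quotientHom (core M))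
  have hf : Function.Surjective f := e.surjective.comp (quotientHom_surjective _)
  have hker : ∀ x, f x = 0 ↔ x ∈ core M := by
    intro x
    rw [← quotientHom_eq_zero]
    exact map_eq_zero_iff e e.injective
  have hfJ : J.map f = ⊤ := by
    refine LOneZero.eq_top_of_ne_bot fun h => hJM fun x hx => (hker x).1 ?_
    rw [← LieSubmodule.mem_bot (R := F) (L := LOneZero F), ← h]
    exact LieIdeal.mem_map hx
  let g : (L ⧸ gamma F L) →ₗ⁅F⁆ LOneZero F :=
    { (gamma F L).toSubmodule.liftQ (f : L →ₗ[F] LOneZero F) fun x hx => (hker x).2 (hγM hx) with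
      map_lie' := fun {x y} => by
        obtain ⟨x, rfl⟩ := quotientHom_surjective _ x
        obtain ⟨y, rfl⟩ := quotientHom_surjective _ y
        exact LieHom.map_lie f x y }
  have hg : ∀ x, g (quotientHom (gamma F L) x) = f x := fun _ => rfl
  have hsurj := quotientHom_surjective (gamma F L)
  refine ⟨J.map (quotientHom (gamma F L)),
    ⟨LieEquiv.ofBijective (g.comp (J.map (quotientHom (gamma F L))).incl) ⟨?_, ?_⟩⟩⟩
  · rw [injective_iff_map_eq_zero]
    rintro ⟨w, hw⟩ h
    obtain ⟨⟨x, hx⟩, rfl⟩ := LieIdeal.mem_map_of_surjective hsurj hw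
    have hxM : x ∈ core M := (hker x).1 h
    have hxγ : x ∈ gamma F L := hinf ▸ ⟨hx, hxM⟩
    exact Subtype.ext (quotientHom_eq_zero.2 hxγ)
  · intro w
    obtain ⟨⟨x, hx⟩, rfl⟩ := LieIdeal.mem_map_of_surjective hf
      (hfJ ▸ LieSubmodule.mem_top w : w ∈ J.map f)
    exact ⟨⟨quotientHom _ x, LieIdeal.mem_map hx⟩, rfl⟩

end NonSolvable

end EngelMax

theorem corollary3p5 {F L : Type*} [Field F] [LieRing L] [LieAlgebra F L]
    [FiniteDimensional F L]
    (hF : (Module.finrank F L : Cardinal) ≤ Cardinal.mk F) :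
    EngelMax.IsSupersolvable F L ↔
      EngelMax.delta F L = ⊤ ∧
        ¬ ∃ I : LieIdeal F (L ⧸ EngelMax.gamma F L),
          Nonempty (I ≃ₗ⁅F⁆ EngelMax.LOneZero F) := by
  rw [EngelMax.delta_eq_top_iff]
  constructor
  · intro h
    refine ⟨h.maxEngelCodimOne, ?_⟩
    rintro ⟨I, ⟨e⟩⟩
    have := h.isSolvable
    have : LieAlgebra.IsSolvable (L ⧸ EngelMax.gamma F L) :=
      (EngelMax.quotientHom_surjective _).lieAlgebra_isSolvable
    exact EngelMax.LOneZero.not_isSolvable (e.surjective.lieAlgebra_isSolvable)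
  · rintro ⟨hC, hI⟩
    have hsol : LieAlgebra.IsSolvable L := by
      by_contra hsol
      exact hI (EngelMax.exists_ideal_lieEquiv hF hC hsol)
    exact EngelMax.isSupersolvable_of_finrank_eq _ L rfl hC
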